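/- Let $k\ge 1$, $\mathbf n=(n_1,\dots,n_k)$ with $n_i\ge 1$, let $\mathbb F_{n}^+$ be the unital free semigroup on $n$ generators (with length $|\cdot|$ and word reversal $\widetilde{\ \cdot\ }$), and put $\mathbf F_{\mathbf n}^+=\mathbb F_{n_1}^+\times\cdots\times\mathbb F_{n_k}^+$, with componentwise reversal $\widetilde{\boldsymbol\alpha}$. For operators $X=(X_{i,j})$, $1\le i\le k$, $1\le j\le n_i$, on a Hilbert space write $X_{\boldsymbol\alpha}=X_{1,\alpha_1}\cdots X_{k,\alpha_k}$, where $X_{i,\alpha_i}$ is the product of the $X_{i,j}$ along the word $\alpha_i$. For a complex Hilbert space $\mathcal H$, the regular polyball $\mathbf B_{\mathbf n}(\mathcal H)$ is the set of all tuples $X=(X_{i,j})$ in $B(\mathcal H)$ such that $X_{i,s}X_{i',t}=X_{i',t}X_{i,s}$ for $i\ne i'$, $\|\sum_j X_{i,j}X_{i,j}^*\|<1$ for every $i$, and $(\mathrm{id}-\Phi_{X_1})\circ\cdots\circ(\mathrm{id}-\Phi_{X_k})(I)$ is positive and invertible, where $\Phi_{X_i}(Y)=\sum_j X_{i,j}YX_{i,j}^*$.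 Let $\mathcal E$ be a complex Hilbert space. For coefficients $A_{(\boldsymbol\alpha;\boldsymbol\beta)}\in B(\mathcal E)$ consider the series $$\sum_{m\in\mathbb Z^k}\ \sum_{|\alpha_i|=m_i^-,\ |\beta_i|=m_i^+\ (1\le i\le k)}A_{(\boldsymbol\alpha;\boldsymbol\beta)}\otimes X_{\boldsymbol\alpha}X_{\boldsymbol\beta}^*,\qquad m_i^{+}=\max(m_i,0),\ m_i^-=\max(-m_i,0),\qquad(*)$$ where the inner sums are finite and convergence of the outer sum over $m$ is unconditional, in the operator norm. Let $F$ be a map that assigns to every Hilbert space $\mathcal H$ a function $F:\mathbf B_{\mathbf n}(\mathcal H)\to B(\mathcal E)\otimes_{\min}B(\mathcal H)$. It is called free $k$-pluriharmonic if there are coefficients $A_{(\boldsymbol\alpha;\boldsymbol\beta)}\in B(\mathcal E)$, independent of $\mathcal H$, such that for every $\mathcal H$ and every $X\in\mathbf B_{\mathbf n}(\mathcal H)$ the series $(*)$ converges to $F(X)$; it is called positive if $F(X)\ge 0$ for every $\mathcal H$ and every $X\in\mathbf B_{\mathbf n}(\mathcal H)$. **Theorem.** Suppose that $F(0)=I$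 for every $\mathcal H$. Then $F$ is a positive free $k$-pluriharmonic function if and only if there are a Hilbert space $\mathcal K\supset\mathcal E$ and a $k$-tuple $V=(V_1,\dots,V_k)$ of commuting row isometries $V_i=(V_{i,1},\dots,V_{i,n_i})$ on $\mathcal K$ (that is, $V_{i,s}^*V_{i,t}=\delta_{st}I$, and $V_{i,s}V_{i',t}=V_{i',t}V_{i,s}$ for $i\neq i'$) such that, with $A_{(\boldsymbol\alpha;\boldsymbol\beta)}:=P_{\mathcal E}V_{\widetilde{\boldsymbol\alpha}}^*V_{\widetilde{\boldsymbol\beta}}|_{\mathcal E}$: 1. for every $r\in[0,1)$ the series $(*)$ at $r\mathbf S$, $$\sum_{m\in\mathbb Z^k}\ \sum_{|\alpha_i|=m_i^-,\ |\beta_i|=m_i^+}P_{\mathcal E}V_{\widetilde{\boldsymbol\alpha}}^*V_{\widetilde{\boldsymbol\beta}}|_{\mathcal E}\otimes r^{|\boldsymbol\alpha|+|\boldsymbol\beta|}\,\mathbf S_{\boldsymbol\alpha}\mathbf S_{\boldsymbol\beta}^*,$$ where $|\boldsymbol\alpha|=\sum_i|\alpha_i|$, converges in the operator norm and its sum is a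 positive operator; here $\mathbf S=(\mathbf S_{i,j})$ are the left creation operators on $F^2(H_{n_1})\otimes\cdots\otimes F^2(H_{n_k})$, the tensor product of the full Fock spaces on $n_1,\dots,n_k$ generators, with $\mathbf S_{i,j}$ acting on the $i$-th factor; 2. for every $\mathcal H$ and every $X\in\mathbf B_{\mathbf n}(\mathcal H)$, $$F(X)=\sum_{m\in\mathbb Z^k}\ \sum_{|\alpha_i|=m_i^-,\ |\beta_i|=m_i^+}P_{\mathcal E}V_{\widetilde{\boldsymbol\alpha}}^*V_{\widetilde{\boldsymbol\beta}}|_{\mathcal E}\otimes X_{\boldsymbol\alpha}X_{\boldsymbol\beta}^*,$$ with convergence in the operator norm. -/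

import Mathlib

open scoped TensorProduct ENNReal

universe u v

namespace Polyball

noncomputable section

/-! ### Words and monomials -/

/-- The direct product of the unital free semigroups on `n i` generators, `i : Fin k`. -/
abbrev MultiWord {k : ℕ} (n : Fin k → ℕ) : Type := ∀ i, FreeMonoid (Fin (n i))

/-- The componentwise reverse of a tuple of words. -/
def MultiWord.rev {k : ℕ} {n : Fin k → ℕ} (a : MultiWord n) : MultiWord n :=
  fun i => (a i).reverse

/-- A tuple of words with prescribed lengths, seen as an element of the direct product of the free
semigroups. -/
def MultiWord.ofLetters {k : ℕ} {n : Fin k → ℕ} {p : Fin k → ℕ}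
    (w : ∀ i, Fin (p i) → Fin (n i)) : MultiWord n :=
  fun i => FreeMonoid.ofList (List.ofFn (w i))

/-- `X_α = X_{1,α_1} ⋯ X_{k,α_k}`, where `X_{i,g_{j_1} ⋯ g_{j_p}} = X_{i,j_1} ⋯ X_{i,j_p}`. -/
def monomial {k : ℕ} {n : Fin k → ℕ} {H : Type u} [NormedAddCommGroup H] [InnerProductSpace ℂ H]
    (X : ∀ i, Fin (n i) → (H →L[ℂ] H)) (a : MultiWord n) : H →L[ℂ] H :=
  (List.ofFn fun i => FreeMonoid.lift (X i) (a i)).prod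

/-! ### The regular polyball -/

/-- The map `Y ↦ ∑ j, X j * Y * (X j)^*`. -/
def rowMap {m : ℕ} {H : Type u} [NormedAddCommGroup H] [InnerProductSpace ℂ H] [CompleteSpace H]
    (X : Fin m → (H →L[ℂ] H)) : Module.End ℂ (H →L[ℂ] H) :=
  ∑ j, (LinearMap.mulLeft ℂ (X j)) ∘ₗ (LinearMap.mulRight ℂ (ContinuousLinearMap.adjoint (X j)))

/-- The defect mapping `(id - Φ_{X_1}) ∘ ⋯ ∘ (id - Φ_{X_k})`. -/
def defectMap {k : ℕ} {n : Fin k → ℕ} {H : Type u} [NormedAddCommGroup H] [InnerProductSpace ℂ H]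
    [CompleteSpace H] (X : ∀ i, Fin (n i) → (H →L[ℂ] H)) : Module.End ℂ (H →L[ℂ] H) :=
  (List.ofFn fun i => (1 - rowMap (X i) : Module.End ℂ (H →L[ℂ] H))).prod

/-- The entries of different rows commute (entries of the same row need not commute). -/
def RowsCommute {k : ℕ} {n : Fin k → ℕ} {H : Type u} [NormedAddCommGroup H]
    [InnerProductSpace ℂ H] (X : ∀ i, Fin (n i) → (H →L[ℂ] H)) : Prop :=
  ∀ i i', i ≠ i' → ∀ s t, Commute (X i s) (X i' t)

/-- The regular polyball on the Hilbert space `H`: the rows commute with each other, each of them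
is a strict row contraction, and the defect operator is positive and invertible. -/
def regularPolyball {k : ℕ} (n : Fin k → ℕ) (H : Type u) [NormedAddCommGroup H]
    [InnerProductSpace ℂ H] [CompleteSpace H] : Set (∀ i, Fin (n i) → (H →L[ℂ] H)) :=
  {X | RowsCommute X ∧ (∀ i, ‖∑ j, X i j * ContinuousLinearMap.adjoint (X i j)‖ < 1) ∧
    (defectMap X 1).IsPositive ∧ IsUnit (defectMap X 1)}

theorem zero_mem_regularPolyball {k : ℕ} (n : Fin k → ℕ) (H : Type u) [NormedAddCommGroup H]
    [InnerProductSpace ℂ H] [CompleteSpace H] :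
    (0 : ∀ i, Fin (n i) → (H →L[ℂ] H)) ∈ regularPolyball n H := by
  have h : defectMap (0 : ∀ i, Fin (n i) → (H →L[ℂ] H)) = 1 := by
    have h0 : ∀ i, rowMap (0 : Fin (n i) → (H →L[ℂ] H)) = 0 := by
      intro i
      ext Y x
      simp [rowMap]
    simp [defectMap, h0, List.ofFn_const]
  refine ⟨fun i i' _ s t => Commute.zero_left _, fun i => by simp, ?_, ?_⟩
  · rw [h]
    exact ContinuousLinearMap.isPositive_one
  · rw [h]
    exact isUnit_one

instance {k : ℕ} (n : Fin k → ℕ) (H : Type u) [NormedAddCommGroup H]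
    [InnerProductSpace ℂ H] [CompleteSpace H] : Zero (regularPolyball n H) :=
  ⟨⟨0, zero_mem_regularPolyball n H⟩⟩

/-! ### Hilbert tensor products -/

/-- The Hilbert space tensor product: the completion of the algebraic tensor product for the
inner product with `⟪x ⊗ y, x' ⊗ y'⟫ = ⟪x, x'⟫ ⟪y, y'⟫`. -/
abbrev HilbertTensor (E : Type v) (H : Type u) [NormedAddCommGroup E] [InnerProductSpace ℂ E]
    [NormedAddCommGroup H] [InnerProductSpace ℂ H] : Type (max u v) :=
  UniformSpace.Completion (E ⊗[ℂ] H)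

/-- The bounded operator `A ⊗ B` on the Hilbert space tensor product. -/
def opTensor {E : Type v} {H : Type u} [NormedAddCommGroup E] [InnerProductSpace ℂ E]
    [NormedAddCommGroup H] [InnerProductSpace ℂ H] (A : E →L[ℂ] E) (B : H →L[ℂ] H) :
    HilbertTensor E H →L[ℂ] HilbertTensor E H :=
  (UniformSpace.Completion.toComplL ∘L TensorProduct.mapL A B).extend
    UniformSpace.Completion.toComplL

theorem opTensor_tmul {E : Type v} {H : Type u} [NormedAddCommGroup E] [InnerProductSpace ℂ E]
    [NormedAddCommGroup H] [InnerProductSpace ℂ H] (A : E →L[ℂ] E) (B : H →L[ℂ] H)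
    (x : E) (y : H) :
    opTensor A B ((x ⊗ₜ[ℂ] y : E ⊗[ℂ] H) : HilbertTensor E H) =
      ((A x ⊗ₜ[ℂ] B y : E ⊗[ℂ] H) : HilbertTensor E H) := by
  have h := ContinuousLinearMap.extend_eq
    (UniformSpace.Completion.toComplL ∘L TensorProduct.mapL A B)
    (e := (UniformSpace.Completion.toComplL : (E ⊗[ℂ] H) →L[ℂ] HilbertTensor E H))
    UniformSpace.Completion.denseRange_coe
    (UniformSpace.Completion.isUniformInducing_coe _) (x ⊗ₜ[ℂ] y)
  simpa [opTensor] using h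

/-- The minimal (spatial) tensor product of `B(E)` and `B(H)`: the operator norm closure of the
linear span of the operators `A ⊗ B` in the bounded operators on the Hilbert tensor product. -/
def minTensor (E : Type v) (H : Type u) [NormedAddCommGroup E] [InnerProductSpace ℂ E]
    [NormedAddCommGroup H] [InnerProductSpace ℂ H] :
    Submodule ℂ (HilbertTensor E H →L[ℂ] HilbertTensor E H) :=
  (Submodule.span ℂ {T | ∃ (A : E →L[ℂ] E) (B : H →L[ℂ] H), T = opTensor A B}).topologicalClosure

/-! ### The Fock space and the left creation operators -/

/-- The Hilbert tensor product of the full Fock spaces on `n i` generators, `i : Fin k`, realized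
through its canonical orthonormal basis `e_{α_1} ⊗ ⋯ ⊗ e_{α_k}`, indexed by tuples of words. -/
abbrev Fock {k : ℕ} (n : Fin k → ℕ) : Type := lp (fun _ : MultiWord n => ℂ) 2

/-- The canonical orthonormal basis of the Fock space. -/
def fockBasis {k : ℕ} (n : Fin k → ℕ) : HilbertBasis (MultiWord n) ℂ (Fock n) :=
  ⟨LinearIsometryEquiv.refl ℂ _⟩

/-- The tuple of words all of whose components are empty, except for the `i`-th one, which is the
`j`-th generator. -/
def generator {k : ℕ} {n : Fin k → ℕ} (i : Fin k) (j : Fin (n i)) : MultiWord n :=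
  Pi.mulSingle i (FreeMonoid.of j)

theorem orthonormal_shift {k : ℕ} {n : Fin k → ℕ} (g : MultiWord n) :
    Orthonormal ℂ fun a : MultiWord n => fockBasis n (g * a) :=
  (fockBasis n).orthonormal.comp _ (mul_right_injective g)

/-- The left creation operator `S_{i,j}` (acting on the `i`-th tensor factor), i.e. the isometry
that maps the basis vector with index `a` to the one with index `generator i j * a`. -/
def creation {k : ℕ} (n : Fin k → ℕ) (i : Fin k) (j : Fin (n i)) : Fock n →L[ℂ] Fock n :=
  ((orthonormal_shift (generator i j)).orthogonalFamily.linearIsometry).toContinuousLinearMap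

theorem creation_basis {k : ℕ} (n : Fin k → ℕ) (i : Fin k) (j : Fin (n i)) (a : MultiWord n) :
    creation n i j (fockBasis n a) = fockBasis n (generator i j * a) := by
  classical
  have h : ∀ b : MultiWord n, fockBasis n b = lp.single 2 b (1 : ℂ) := fun b =>
    ((fockBasis n).repr_symm_single b).symm
  rw [h a]
  simp [creation]

/-! ### Free pluriharmonic functions -/

/-- The homogeneous part of multi-degree `m` of the series with coefficients `A` at `X`, i.e. the
finite sum of `A (α; β) ⊗ X_α X_β^*` over all `α`, `β` with `|α_i| = m_i^-`, `|β_i| = m_i^+`.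
(Since the rows of `X` commute, `X_β^* = X_{1,β_1}^* ⋯ X_{k,β_k}^*`.) -/
def homogeneousPart {k : ℕ} {n : Fin k → ℕ} {E : Type v} {H : Type u}
    [NormedAddCommGroup E] [InnerProductSpace ℂ E]
    [NormedAddCommGroup H] [InnerProductSpace ℂ H] [CompleteSpace H]
    (A : MultiWord n → MultiWord n → (E →L[ℂ] E)) (X : ∀ i, Fin (n i) → (H →L[ℂ] H))
    (m : Fin k → ℤ) : HilbertTensor E H →L[ℂ] HilbertTensor E H :=
  ∑ a : (∀ i, Fin (-m i).toNat → Fin (n i)), ∑ b : (∀ i, Fin (m i).toNat → Fin (n i)),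
    opTensor (A (MultiWord.ofLetters a) (MultiWord.ofLetters b))
      (monomial X (MultiWord.ofLetters a) *
        ContinuousLinearMap.adjoint (monomial X (MultiWord.ofLetters b)))

/-- The series with coefficients `A` converges at `X`, in the operator norm topology and
independently of the order of the summation over `m`, to the operator `T`. -/
def SeriesConverges {k : ℕ} {n : Fin k → ℕ} {E : Type v} {H : Type u}
    [NormedAddCommGroup E] [InnerProductSpace ℂ E]
    [NormedAddCommGroup H] [InnerProductSpace ℂ H] [CompleteSpace H]
    (A : MultiWord n → MultiWord n → (E →L[ℂ] E)) (X : ∀ i, Fin (n i) → (H →L[ℂ] H))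
    (T : HilbertTensor E H →L[ℂ] HilbertTensor E H) : Prop :=
  HasSum (homogeneousPart A X) T

/-- A map defined on the abstract regular polyball, with values in the minimal tensor products:
for every Hilbert space `H`, a map from the regular polyball on `H` to `B(E) ⊗_min B(H)`. -/
abbrev PolyballMap {k : ℕ} (n : Fin k → ℕ) (E : Type v) [NormedAddCommGroup E]
    [InnerProductSpace ℂ E] : Type (max (u + 1) v) :=
  ∀ (H : Type u) [NormedAddCommGroup H] [InnerProductSpace ℂ H] [CompleteSpace H],
    regularPolyball n H → minTensor E H

/-- `F` is free `k`-pluriharmonic with coefficients in `B(E)`: it is given by one series, with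
the same coefficients for all Hilbert spaces, that converges on the whole polyball. -/
def IsFreePluriharmonic {k : ℕ} {n : Fin k → ℕ} {E : Type v} [NormedAddCommGroup E]
    [InnerProductSpace ℂ E] (F : PolyballMap.{u, v} n E) : Prop :=
  ∃ A : MultiWord n → MultiWord n → (E →L[ℂ] E),
    ∀ (H : Type u) [NormedAddCommGroup H] [InnerProductSpace ℂ H] [CompleteSpace H]
      (X : regularPolyball n H), SeriesConverges A X.1 (F H X).1

/-- `F` is positive: all its values are positive operators. -/
def IsPositiveMap {k : ℕ} {n : Fin k → ℕ} {E : Type v} [NormedAddCommGroup E]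
    [InnerProductSpace ℂ E] (F : PolyballMap.{u, v} n E) : Prop :=
  ∀ (H : Type u) [NormedAddCommGroup H] [InnerProductSpace ℂ H] [CompleteSpace H]
    (X : regularPolyball n H), (F H X).1.IsPositive

/-! ### Commuting row isometries -/

/-- Each `(V_{i,1}, …, V_{i,n_i})` is a row isometry, i.e. consists of isometries with mutually
orthogonal ranges, and entries of different rows commute. -/
def IsCommutingRowIsometries {k : ℕ} {n : Fin k → ℕ} {K : Type v} [NormedAddCommGroup K]
    [InnerProductSpace ℂ K] [CompleteSpace K] (V : ∀ i, Fin (n i) → (K →L[ℂ] K)) : Prop :=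
  (∀ i s t, ContinuousLinearMap.adjoint (V i s) * V i t = if s = t then 1 else 0) ∧ RowsCommute V

/-- The operators `P_E V_{α~}^* V_{β~}|_E` on `E`, where `α~` is the reverse of `α` and `E` is
regarded as a subspace of `K` through the isometric embedding `ι`. -/
def compressionCoeff {k : ℕ} {n : Fin k → ℕ} {E K : Type v}
    [NormedAddCommGroup E] [InnerProductSpace ℂ E] [CompleteSpace E]
    [NormedAddCommGroup K] [InnerProductSpace ℂ K] [CompleteSpace K]
    (ι : E →ₗᵢ[ℂ] K) (V : ∀ i, Fin (n i) → (K →L[ℂ] K)) (a b : MultiWord n) : E →L[ℂ] E :=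
  ContinuousLinearMap.adjoint ι.toContinuousLinearMap ∘L
    (ContinuousLinearMap.adjoint (monomial V a.rev) * monomial V b.rev) ∘L
      ι.toContinuousLinearMap

end

end Polyball

/-!
# Positive free pluriharmonic functions on regular polyballs

If `F` is positive and pluriharmonic with coefficients `A`, its values at the dilated creation
operators `r S` are positive operators. The matrix of such a value in the canonical basis of the
Fock space is, up to powers of `r`, the multi-Toeplitz kernel `toeplitz A`: the entry at `(σ, ω)`
is the coefficient at the pair obtained from `(σ, ω)` by cancelling the largest common suffixes, if
that leaves an empty word in each coordinate of the pair, and zero otherwise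
(`SeriesConverges.inner_fockBasis`). Letting `r` tend to `1`, the kernel is positive semidefinite
(`posSemidef_toeplitz`), so it is the kernel of a reproducing kernel Hilbert space `K`. Since it is
invariant under right multiplication of both indices by a generator, and vanishes at indices that
end in different letters of the same row, the maps that send the kernel function at `ω` to the one
at `ω * generator i j` extend to commuting row isometries on `K`
(`exists_commutingRowIsometries`), and compressing them to the copy of `E` at the empty words
returns the coefficients. Only coefficients at reduced pairs occur in the series, so these
compressions may be used as coefficients of `F`. The points `r S` belong to the polyball because the
creation operators on different tensor factors doubly commute (`smul_mem_regularPolyball`); a copy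
of the Fock space in the universe of the Hilbert spaces on which `F` is defined serves as carrier.

Conversely, only the positivity of `F` has to be proved. A point `X` of the polyball has a
noncommutative Poisson kernel, an isometry from `H` to the tensor product of the Fock space and the
range of the defect operator that intertwines the adjoints of `X` with those of the creation
operators (`exists_poisson_kernel`); that it is isometric is a telescoping sum over boxes of words
(`hasSum_norm_sq_defect`). It expresses the series at `r X` through the positive operators at
`r S`, and the positivity at `X` follows by letting `r` tend to `1` in each matrix entry, an
absolutely convergent scalar series (`isPositive_of_seriesConverges`).
-/

namespace Polyball

noncomputable section

open ContinuousLinearMap (adjoint)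
open Filter Topology

/-! ### Words and monomials -/

section ListProd

variable {M : Type*} [Monoid M]

/-- An ordered product of products splits when factors with different indices commute. -/
theorem prod_ofFn_mul_of_commute {k : ℕ} (f g : Fin k → M)
    (h : ∀ i j, i ≠ j → Commute (f i) (g j)) :
    (List.ofFn fun i => f i * g i).prod = (List.ofFn f).prod * (List.ofFn g).prod := by
  induction k with
  | zero => simp
  | succ k ih =>
    have hc : Commute (List.ofFn fun i : Fin k => f i.succ).prod (g 0) := by
      apply Commute.list_prod_left
      intro x hx
      obtain ⟨i, rfl⟩ := List.mem_ofFn.1 hx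
      exact h _ _ (Fin.succ_ne_zero i)
    simp only [List.ofFn_succ, List.prod_cons]
    rw [ih (fun i => f i.succ) (fun i => g i.succ) fun i j hij =>
      h _ _ fun e => hij (Fin.succ_injective _ e)]
    simp only [mul_assoc]
    rw [← mul_assoc (g 0), ← hc.eq, mul_assoc]

theorem prod_ofFn_mulSingle {k : ℕ} (i : Fin k) (x : M) :
    (List.ofFn (Pi.mulSingle i x : Fin k → M)).prod = x := by
  induction k with
  | zero => exact i.elim0
  | succ k ih =>
    rw [List.ofFn_succ, List.prod_cons]
    refine Fin.cases ?_ (fun i => ?_) i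
    · simp [List.ofFn_const]
    · have h : (fun j : Fin k => (Pi.mulSingle i.succ x : Fin (k + 1) → M) j.succ) =
          Pi.mulSingle i x := by
        funext j
        by_cases hj : j = i
        · subst hj; simp
        · rw [Pi.mulSingle_eq_of_ne hj,
            Pi.mulSingle_eq_of_ne fun e => hj (Fin.succ_injective _ e)]
      rw [h, ih, Pi.mulSingle_eq_of_ne (Fin.succ_ne_zero i).symm, one_mul]

end ListProd

section Words

variable {k : ℕ} {n : Fin k → ℕ}

/-- Induction on tuples of words by left multiplication with generators. -/
theorem MultiWord.induction {p : MultiWord n → Prop} (one : p 1)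
    (mul : ∀ i j a, p a → p (generator i j * a)) (a : MultiWord n) : p a := by
  -- strong induction on the total length, splitting off the first letter of a nonempty coordinate
  induction hN : ∑ i, (a i).length using Nat.strong_induction_on generalizing a with
  | _ N ih =>
    by_cases h : ∀ i, a i = 1
    · rwa [show a = 1 from funext h]
    · push Not at h
      obtain ⟨i, hi⟩ := h
      obtain ⟨j, w, hw⟩ : ∃ j w, a i = FreeMonoid.of j * w := by
        revert hi
        refine FreeMonoid.casesOn (a i) (fun h => (h rfl).elim) fun j w _ => ⟨j, w, rfl⟩
      have ha : a = generator i j * Function.update a i w := by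
        funext i'
        by_cases hi' : i' = i
        · subst hi'; simp [generator, hw]
        · simp [generator, hi']
      rw [ha]
      refine mul _ _ _ (ih _ ?_ _ rfl)
      rw [← hN]
      refine Finset.sum_lt_sum (fun i' _ => ?_) ⟨i, Finset.mem_univ _, ?_⟩
      · by_cases hi' : i' = i
        · subst hi'; simp [hw]
        · simp [hi']
      · simp [hw]

/-- The total length `∑ i, |α_i|` of a tuple of words. -/
def MultiWord.length (a : MultiWord n) : ℕ := ∑ i, (a i).length

theorem MultiWord.length_ofLetters {p : Fin k → ℕ} (w : ∀ i, Fin (p i) → Fin (n i)) :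
    (MultiWord.ofLetters w).length = ∑ i, p i := by
  simp [MultiWord.length, MultiWord.ofLetters, FreeMonoid.length]

theorem MultiWord.exists_ofLetters {a : MultiWord n} {p : Fin k → ℕ}
    (h : ∀ i, (a i).length = p i) : ∃ w : ∀ i, Fin (p i) → Fin (n i), MultiWord.ofLetters w = a := by
  obtain rfl : p = fun i => (a i).length := (funext h).symm
  exact ⟨fun i => (FreeMonoid.toList (a i)).get, funext fun i =>
    congrArg FreeMonoid.ofList (List.ofFn_get _)⟩

theorem MultiWord.ofLetters_injective {p : Fin k → ℕ} :
    Function.Injective (MultiWord.ofLetters : (∀ i, Fin (p i) → Fin (n i)) → MultiWord n) := by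
  intro w w' h
  funext i
  exact List.ofFn_injective (FreeMonoid.ofList.injective (congrFun h i))

theorem MultiWord.length_ofLetters_apply {p : Fin k → ℕ} (w : ∀ i, Fin (p i) → Fin (n i))
    (i : Fin k) : (MultiWord.ofLetters w i).length = p i := by
  simp [MultiWord.ofLetters, FreeMonoid.length]

end Words

section Monomial

variable {k : ℕ} {n : Fin k → ℕ} {H : Type u} [NormedAddCommGroup H] [InnerProductSpace ℂ H]
  {X : ∀ i, Fin (n i) → (H →L[ℂ] H)}

theorem op_mul_apply (a b : H →L[ℂ] H) (h : H) : (a * b) h = a (b h) := rfl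

theorem commute_lift {i i' : Fin k} (hX : RowsCommute X) (h : i ≠ i') (a : FreeMonoid (Fin (n i)))
    (b : FreeMonoid (Fin (n i'))) :
    Commute (FreeMonoid.lift (X i) a) (FreeMonoid.lift (X i') b) := by
  simp only [FreeMonoid.lift_apply]
  apply Commute.list_prod_left
  intro x hx
  apply Commute.list_prod_right
  intro y hy
  simp only [List.mem_map] at hx hy
  obtain ⟨s, -, rfl⟩ := hx
  obtain ⟨t, -, rfl⟩ := hy
  exact hX _ _ h s t

theorem monomial_mul (hX : RowsCommute X) (a b : MultiWord n) :
    monomial X (a * b) = monomial X a * monomial X b := by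
  simp only [monomial, Pi.mul_apply, map_mul]
  exact prod_ofFn_mul_of_commute _ _ fun i j hij => commute_lift hX hij _ _

@[simp]
theorem monomial_one : monomial X 1 = 1 := by
  simp [monomial, List.ofFn_const]

@[simp]
theorem monomial_generator (i : Fin k) (j : Fin (n i)) : monomial X (generator i j) = X i j := by
  rw [monomial, ← prod_ofFn_mulSingle i (X i j)]
  congr 2
  funext i'
  by_cases h : i' = i
  · subst h; simp [generator]
  · simp [generator, h]

theorem monomial_smul (c : ℂ) (a : MultiWord n) :
    monomial (fun i j => c • X i j) a = c ^ a.length • monomial X a := by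
  have h : ∀ i, FreeMonoid.lift (fun j => c • X i j) (a i) =
      c ^ (a i).length • FreeMonoid.lift (X i) (a i) := by
    intro i
    induction a i using FreeMonoid.recOn with
    | one => simp
    | of_mul x xs hx =>
      rw [map_mul, map_mul, hx]
      simp [pow_add, smul_smul, mul_comm]
  simp only [monomial, h, MultiWord.length]
  clear h
  induction k with
  | zero => simp
  | succ k ih =>
    simp only [List.ofFn_succ, List.prod_cons]
    have := ih (n := fun i => n i.succ) (X := fun i => X i.succ) (fun i => a i.succ)
    rw [this, Fin.sum_univ_succ, pow_add]
    simp [smul_smul, mul_comm]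

/-- Monomials are natural with respect to intertwiners of the generating operators. -/
theorem monomial_intertwine {H' : Type*} [NormedAddCommGroup H'] [InnerProductSpace ℂ H']
    {X' : ∀ i, Fin (n i) → (H' →L[ℂ] H')} (hX : RowsCommute X) (hX' : RowsCommute X')
    (J : H' →L[ℂ] H) (h : ∀ i j, J ∘L X' i j = X i j ∘L J) (a : MultiWord n) :
    J ∘L monomial X' a = monomial X a ∘L J := by
  induction a using MultiWord.induction with
  | one => ext; simp
  | mul i j a ih =>
    rw [monomial_mul hX, monomial_mul hX', monomial_generator, monomial_generator]
    calc J ∘L (X' i j ∘L monomial X' a) = (J ∘L X' i j) ∘L monomial X' a := rfl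
      _ = X i j ∘L (J ∘L monomial X' a) := by rw [h]; rfl
      _ = _ := by rw [ih]; rfl

end Monomial

/-! ### Operators on Hilbert tensor products -/

section Tensor

variable {E : Type v} [NormedAddCommGroup E] [InnerProductSpace ℂ E]
variable {H : Type*} [NormedAddCommGroup H] [InnerProductSpace ℂ H]
variable {H' : Type*} [NormedAddCommGroup H'] [InnerProductSpace ℂ H']

theorem tensor_coe_zero : ((0 : E ⊗[ℂ] H) : HilbertTensor E H) = 0 :=
  UniformSpace.Completion.coe_zero

theorem hilbertTensor_ext {G : Type*} [NormedAddCommGroup G] [NormedSpace ℂ G]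
    {S T : HilbertTensor E H →L[ℂ] G}
    (h : ∀ (x : E) (y : H), S ((x ⊗ₜ[ℂ] y : E ⊗[ℂ] H) : HilbertTensor E H) =
      T ((x ⊗ₜ[ℂ] y : E ⊗[ℂ] H) : HilbertTensor E H)) : S = T := by
  ext z
  induction z using UniformSpace.Completion.induction_on with
  | hp => exact isClosed_eq S.continuous T.continuous
  | ih a =>
    induction a using TensorProduct.induction_on with
    | zero => rw [tensor_coe_zero, map_zero, map_zero]
    | tmul x y => exact h x y
    | add a b ha hb => rw [UniformSpace.Completion.coe_add, map_add, map_add, ha, hb]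

open scoped ComplexOrder in
theorem isPositive_of_inner_nonneg {T : HilbertTensor E H →L[ℂ] HilbertTensor E H}
    (h : ∀ z : E ⊗[ℂ] H, 0 ≤ inner ℂ (z : HilbertTensor E H) (T (z : HilbertTensor E H))) :
    T.IsPositive := by
  have h' : ∀ z : HilbertTensor E H, 0 ≤ inner ℂ z (T z) := by
    intro z
    induction z using UniformSpace.Completion.induction_on with
    | hp => exact isClosed_le continuous_const (continuous_id.inner T.continuous)
    | ih a => exact h a
  refine (ContinuousLinearMap.isPositive_iff_complex T).2 fun z => ?_
  obtain ⟨h1, h2⟩ := Complex.nonneg_iff.1 (h' z)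
  have h3 : inner ℂ (T z) z = (starRingEnd ℂ) (inner ℂ z (T z)) := (inner_conj_symm _ _).symm
  refine ⟨Complex.ext (by simp) ?_, ?_⟩
  · rw [h3, Complex.conj_im, ← h2]; simp
  · rw [h3]; exact h1

/-- The unitary `1 ⊗ U` on Hilbert tensor products. -/
def tensorUnitary (E : Type v) [NormedAddCommGroup E] [InnerProductSpace ℂ E]
    (U : H ≃ₗᵢ[ℂ] H') : HilbertTensor E H ≃ₗᵢ[ℂ] HilbertTensor E H' :=
  (U.lTensor E).toLinearEquiv.extendOfIsometry
    (UniformSpace.Completion.toComplL : (E ⊗[ℂ] H) →L[ℂ] HilbertTensor E H).toLinearMap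
    (UniformSpace.Completion.toComplL : (E ⊗[ℂ] H') →L[ℂ] HilbertTensor E H').toLinearMap
    UniformSpace.Completion.denseRange_coe UniformSpace.Completion.denseRange_coe
    fun x => by simpa using (U.lTensor E).norm_map x

theorem tensorUnitary_tmul (U : H ≃ₗᵢ[ℂ] H') (x : E) (y : H) :
    tensorUnitary E U ((x ⊗ₜ[ℂ] y : E ⊗[ℂ] H) : HilbertTensor E H) =
      ((x ⊗ₜ[ℂ] U y : E ⊗[ℂ] H') : HilbertTensor E H') := by
  have h := (U.lTensor E).toLinearEquiv.extendOfIsometry_eq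
    (UniformSpace.Completion.toComplL : (E ⊗[ℂ] H) →L[ℂ] HilbertTensor E H).toLinearMap
    (UniformSpace.Completion.toComplL : (E ⊗[ℂ] H') →L[ℂ] HilbertTensor E H').toLinearMap
    UniformSpace.Completion.denseRange_coe UniformSpace.Completion.denseRange_coe
    (fun x => by simpa using (U.lTensor E).norm_map x) (x ⊗ₜ y)
  simpa [tensorUnitary] using h

theorem tensorUnitary_symm_tmul (U : H ≃ₗᵢ[ℂ] H') (x : E) (y : H') :
    (tensorUnitary E U).symm ((x ⊗ₜ[ℂ] y : E ⊗[ℂ] H') : HilbertTensor E H') =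
      ((x ⊗ₜ[ℂ] U.symm y : E ⊗[ℂ] H) : HilbertTensor E H) := by
  rw [LinearIsometryEquiv.symm_apply_eq, tensorUnitary_tmul, U.apply_symm_apply]

theorem conj_tensorUnitary_opTensor [CompleteSpace H] [CompleteSpace H'] (U : H ≃ₗᵢ[ℂ] H')
    (A : E →L[ℂ] E) (B : H →L[ℂ] H) :
    (tensorUnitary E U).conjStarAlgEquiv (opTensor A B) = opTensor A (U.conjStarAlgEquiv B) := by
  apply hilbertTensor_ext
  intro x y
  rw [LinearIsometryEquiv.conjStarAlgEquiv_apply_apply, tensorUnitary_symm_tmul, opTensor_tmul,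
    tensorUnitary_tmul, opTensor_tmul, LinearIsometryEquiv.conjStarAlgEquiv_apply_apply]

theorem inner_opTensor_tmul (A : E →L[ℂ] E) (B : H →L[ℂ] H) (x x' : E) (y y' : H) :
    inner ℂ ((x' ⊗ₜ[ℂ] y' : E ⊗[ℂ] H) : HilbertTensor E H)
      (opTensor A B ((x ⊗ₜ[ℂ] y : E ⊗[ℂ] H) : HilbertTensor E H)) =
        inner ℂ x' (A x) * inner ℂ y' (B y) := by
  rw [opTensor_tmul, UniformSpace.Completion.inner_coe, TensorProduct.inner_tmul]

end Tensor

section Transport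

variable {k : ℕ} {n : Fin k → ℕ} {E : Type v} [NormedAddCommGroup E] [InnerProductSpace ℂ E]
variable {H : Type*} [NormedAddCommGroup H] [InnerProductSpace ℂ H] [CompleteSpace H]
variable {H' : Type*} [NormedAddCommGroup H'] [InnerProductSpace ℂ H'] [CompleteSpace H']

theorem monomial_conj (U : H ≃ₗᵢ[ℂ] H') (X : ∀ i, Fin (n i) → (H →L[ℂ] H)) (a : MultiWord n) :
    monomial (fun i j => U.conjStarAlgEquiv (X i j)) a = U.conjStarAlgEquiv (monomial X a) := by
  have h : ∀ i, FreeMonoid.lift (fun j => U.conjStarAlgEquiv (X i j)) (a i) =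
      U.conjStarAlgEquiv (FreeMonoid.lift (X i) (a i)) := by
    intro i
    simp only [FreeMonoid.lift_apply, map_list_prod, List.map_map, Function.comp_def]
  simp only [monomial, h, map_list_prod, List.map_ofFn, Function.comp_def]

theorem homogeneousPart_conj (U : H ≃ₗᵢ[ℂ] H') (A : MultiWord n → MultiWord n → (E →L[ℂ] E))
    (X : ∀ i, Fin (n i) → (H →L[ℂ] H)) (m : Fin k → ℤ) :
    homogeneousPart A (fun i j => U.conjStarAlgEquiv (X i j)) m =
      (tensorUnitary E U).conjStarAlgEquiv (homogeneousPart A X m) := by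
  simp only [homogeneousPart, map_sum, conj_tensorUnitary_opTensor, monomial_conj, map_mul]
  simp only [← ContinuousLinearMap.star_eq_adjoint, map_star]

/-- Convergence of the series, and positivity of its sum, are unitarily invariant. -/
theorem SeriesConverges.conj (U : H ≃ₗᵢ[ℂ] H') {A : MultiWord n → MultiWord n → (E →L[ℂ] E)}
    {X : ∀ i, Fin (n i) → (H →L[ℂ] H)} {T : HilbertTensor E H →L[ℂ] HilbertTensor E H}
    (h : SeriesConverges A X T) :
    SeriesConverges A (fun i j => U.conjStarAlgEquiv (X i j))
      ((tensorUnitary E U).conjStarAlgEquiv T) := by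
  unfold SeriesConverges at h ⊢
  rw [show homogeneousPart A (fun i j => U.conjStarAlgEquiv (X i j)) =
    fun m => (tensorUnitary E U).conjStarAlgEquiv (homogeneousPart A X m) from
      funext (homogeneousPart_conj U A X)]
  exact h.map (tensorUnitary E U).conjStarAlgEquiv
    (tensorUnitary E U).toContinuousLinearEquiv.conjContinuousAlgEquiv.continuous

theorem isPositive_conj (U : H ≃ₗᵢ[ℂ] H') {T : H →L[ℂ] H} (h : T.IsPositive) :
    (U.conjStarAlgEquiv T).IsPositive := by
  refine (ContinuousLinearMap.isPositive_iff_complex _).2 fun z => ?_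
  have := (ContinuousLinearMap.isPositive_iff_complex _).1 h (U.symm z)
  rw [LinearIsometryEquiv.conjStarAlgEquiv_apply_apply]
  rwa [← U.inner_map_map, U.apply_symm_apply] at this

/-- The dilation by `r` multiplies the part of multi-degree `m` by `r ^ ∑ |m i|`. -/
theorem homogeneousPart_smul (A : MultiWord n → MultiWord n → (E →L[ℂ] E))
    (X : ∀ i, Fin (n i) → (H →L[ℂ] H)) (r : ℝ) (m : Fin k → ℤ) :
    homogeneousPart A (fun i j => (r : ℂ) • X i j) m =
      ((r ^ ∑ i, (m i).natAbs : ℝ) : ℂ) • homogeneousPart A X m := by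
  simp only [homogeneousPart, Finset.smul_sum]
  refine Finset.sum_congr rfl fun a _ => Finset.sum_congr rfl fun b _ => ?_
  have hlen : ∑ i, (m i).natAbs =
      (MultiWord.ofLetters a).length + (MultiWord.ofLetters b).length := by
    rw [MultiWord.length_ofLetters, MultiWord.length_ofLetters, ← Finset.sum_add_distrib]
    exact Finset.sum_congr rfl fun i _ => by omega
  apply hilbertTensor_ext
  intro x y
  rw [hlen, monomial_smul, monomial_smul, smul_apply, opTensor_tmul,
    opTensor_tmul, ← UniformSpace.Completion.coe_smul, ← TensorProduct.tmul_smul]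
  simp only [← ContinuousLinearMap.star_eq_adjoint, star_smul]
  simp [pow_add, smul_smul, mul_comm]

end Transport

/-! ### Sums over words -/

section WordSums

/-- The words of length less than `N`. -/
def shortWords (m N : ℕ) : Finset (FreeMonoid (Fin m)) :=
  ((Finset.range N).sigma fun p => (Finset.univ : Finset (Fin p → Fin m))).map
    (List.equivSigmaTuple.symm.trans FreeMonoid.ofList).toEmbedding

theorem mem_shortWords {m N : ℕ} {w : FreeMonoid (Fin m)} : w ∈ shortWords m N ↔ w.length < N := by
  rw [shortWords, Finset.mem_map_equiv]
  simp [List.equivSigmaTuple, FreeMonoid.length]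

/-- Distributivity for an ordered product of sums in a noncommutative ring. -/
theorem prod_ofFn_sum {R : Type*} [Ring R] {k : ℕ} {κ : Fin k → Type*} (s : ∀ i, Finset (κ i))
    (f : ∀ i, κ i → R) :
    (List.ofFn fun i => ∑ j ∈ s i, f i j).prod =
      ∑ w ∈ Fintype.piFinset s, (List.ofFn fun i => f i (w i)).prod := by
  classical
  have := (MultilinearMap.mkPiAlgebraFin ℤ k R).map_sum_finset f s
  simpa using this

theorem sum_shortWords {R : Type*} [Ring R] {m : ℕ} (f : Fin m → R) (N : ℕ) :
    ∑ w ∈ shortWords m N, FreeMonoid.lift f w = ∑ p ∈ Finset.range N, (∑ j, f j) ^ p := by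
  rw [shortWords, Finset.sum_map, Finset.sum_sigma]
  refine Finset.sum_congr rfl fun p _ => ?_
  have := prod_ofFn_sum (k := p) (fun _ => (Finset.univ : Finset (Fin m))) fun _ => f
  rw [List.ofFn_const, List.prod_replicate, Fintype.piFinset_univ] at this
  rw [this]
  refine Finset.sum_congr rfl fun w _ => ?_
  simp [FreeMonoid.lift_apply, List.equivSigmaTuple, List.map_ofFn, Function.comp_def]

end WordSums

/-! ### The noncommutative Poisson kernel -/

section Poisson

variable {k : ℕ} {n : Fin k → ℕ} {H : Type u} [NormedAddCommGroup H] [InnerProductSpace ℂ H]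
  [CompleteSpace H]

/-- Conjugation `Y ↦ a Y a^*`, as a monoid homomorphism in `a`. -/
def conjEnd : (H →L[ℂ] H) →* Module.End ℂ (H →L[ℂ] H) where
  toFun a := LinearMap.mulLeft ℂ a ∘ₗ LinearMap.mulRight ℂ (adjoint a)
  map_one' := by
    apply LinearMap.ext
    intro Y
    simp [← ContinuousLinearMap.star_eq_adjoint]
  map_mul' a b := by
    apply LinearMap.ext
    intro Y
    simp [← ContinuousLinearMap.star_eq_adjoint, mul_assoc]

theorem conjEnd_apply (a Y : H →L[ℂ] H) : conjEnd a Y = a * (Y * adjoint a) := rfl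

theorem rowMap_eq_sum_conjEnd {m : ℕ} (X : Fin m → (H →L[ℂ] H)) :
    rowMap X = ∑ j, conjEnd (X j) := rfl

/-- The map `Φ_X` is bounded by `‖Φ_X 1‖`, by the Cauchy-Schwarz inequality. -/
theorem norm_rowMap_apply_le {m : ℕ} (X : Fin m → (H →L[ℂ] H)) (Y : H →L[ℂ] H) :
    ‖rowMap X Y‖ ≤ ‖∑ j, X j * adjoint (X j)‖ * ‖Y‖ := by
  set c := ‖∑ j, X j * adjoint (X j)‖ with hc
  have hsum : ∀ h : H, ∑ j, ‖adjoint (X j) h‖ ^ 2 ≤ c * ‖h‖ ^ 2 := by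
    intro h
    have h1 : ((∑ j, ‖adjoint (X j) h‖ ^ 2 : ℝ) : ℂ) =
        inner ℂ h ((∑ j, X j * adjoint (X j)) h) := by
      rw [sum_apply, inner_sum]
      push_cast
      refine Finset.sum_congr rfl fun j _ => ?_
      rw [Function.comp_apply, ← ContinuousLinearMap.adjoint_inner_left,
        inner_self_eq_norm_sq_to_K]
      rfl
    have h2 : ‖((∑ j, ‖adjoint (X j) h‖ ^ 2 : ℝ) : ℂ)‖ ≤ c * ‖h‖ ^ 2 := by
      rw [h1]
      refine (norm_inner_le_norm _ _).trans ?_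
      have := (∑ j, X j * adjoint (X j)).le_opNorm h
      rw [← hc] at this
      nlinarith [norm_nonneg h]
    rwa [Complex.norm_real, Real.norm_of_nonneg (by positivity)] at h2
  refine ContinuousLinearMap.opNorm_le_bound _ (by positivity) fun h => ?_
  set g := rowMap X Y h with hg
  have h1 : inner ℂ g g = ∑ j, inner ℂ (adjoint (X j) g) (Y (adjoint (X j) h)) := by
    have hg' : g = ∑ j, conjEnd (X j) Y h := by
      rw [hg, rowMap_eq_sum_conjEnd, LinearMap.sum_apply, sum_apply]
    calc inner ℂ g g = inner ℂ g (∑ j, conjEnd (X j) Y h) := by rw [← hg']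
      _ = _ := inner_sum _ _ _
    refine Finset.sum_congr rfl fun j _ => ?_
    rw [conjEnd_apply, op_mul_apply, ← ContinuousLinearMap.adjoint_inner_left]
    rfl
  have h2 : ‖g‖ ^ 2 ≤ ‖Y‖ * ∑ j, ‖adjoint (X j) g‖ * ‖adjoint (X j) h‖ := by
    have : ‖g‖ ^ 2 = ‖inner ℂ g g‖ := by
      rw [inner_self_eq_norm_sq_to_K]; simp
    rw [this, h1, Finset.mul_sum]
    refine norm_sum_le_of_le _ fun j _ => (norm_inner_le_norm _ _).trans ?_
    have := Y.le_opNorm (adjoint (X j) h)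
    nlinarith [norm_nonneg (adjoint (X j) g)]
  have h3 : ∑ j, ‖adjoint (X j) g‖ * ‖adjoint (X j) h‖ ≤ c * (‖g‖ * ‖h‖) := by
    refine (Real.sum_mul_le_sqrt_mul_sqrt _ _ _).trans ?_
    calc _ ≤ √(c * ‖g‖ ^ 2) * √(c * ‖h‖ ^ 2) := by gcongr <;> exact hsum _
      _ = c * (‖g‖ * ‖h‖) := by
        rw [Real.sqrt_mul (norm_nonneg _), Real.sqrt_mul (norm_nonneg _),
          Real.sqrt_sq (norm_nonneg _), Real.sqrt_sq (norm_nonneg _), mul_mul_mul_comm,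
          Real.mul_self_sqrt (norm_nonneg _)]
  have h4 : ‖g‖ * ‖g‖ ≤ (c * ‖Y‖ * ‖h‖) * ‖g‖ := by
    nlinarith [mul_le_mul_of_nonneg_left h3 (norm_nonneg Y)]
  rcases (norm_nonneg g).eq_or_lt with h0 | h0
  · rw [← h0]; positivity
  · exact le_of_mul_le_mul_right h4 h0

theorem norm_rowMap_pow_apply_le {m : ℕ} (X : Fin m → (H →L[ℂ] H)) (Y : H →L[ℂ] H) (N : ℕ) :
    ‖(rowMap X ^ N) Y‖ ≤ ‖∑ j, X j * adjoint (X j)‖ ^ N * ‖Y‖ := by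
  induction N with
  | zero => simp
  | succ N ih =>
    rw [pow_succ', Module.End.mul_apply, pow_succ', mul_assoc]
    exact (norm_rowMap_apply_le X _).trans (by gcongr)

theorem tendsto_prod_one_sub_pow {B : Type*} [NormedAddCommGroup B] [NormedSpace ℂ B] {k : ℕ}
    (Φ : Fin k → Module.End ℂ B) (c : Fin k → ℝ) (hc : ∀ i, c i < 1)
    (hc0 : ∀ i, 0 ≤ c i)
    (hΦ : ∀ i N y, ‖(Φ i ^ N) y‖ ≤ c i ^ N * ‖y‖) (y : B) :
    Tendsto (fun N => (List.ofFn fun i => (1 - Φ i ^ N : Module.End ℂ B)).prod y) atTop (𝓝 y) := by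
  induction k with
  | zero => simp
  | succ k ih =>
    have h := ih (fun i => Φ i.succ) (fun i => c i.succ) (fun i => hc _) (fun i => hc0 _)
      (fun i => hΦ _)
    have h0 : Tendsto (fun N => (Φ 0 ^ N) ((List.ofFn fun i : Fin k => (1 - Φ i.succ ^ N : Module.End ℂ B)).prod y))
        atTop (𝓝 0) := by
      apply squeeze_zero_norm (fun N => hΦ 0 N _)
      simpa using (tendsto_pow_atTop_nhds_zero_of_lt_one (hc0 0) (hc 0)).mul h.norm
    simpa [List.ofFn_succ] using h.sub h0

theorem commute_rowMap {X : ∀ i, Fin (n i) → (H →L[ℂ] H)} (hX : RowsCommute X) {i i' : Fin k}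
    (h : i ≠ i') : Commute (rowMap (X i)) (rowMap (X i')) := by
  rw [rowMap_eq_sum_conjEnd, rowMap_eq_sum_conjEnd]
  exact Commute.sum_left _ _ _ fun s _ => Commute.sum_right _ _ _ fun t _ =>
    (hX i i' h s t).map conjEnd

/-- The partial sum over the box of tuples of words of length less than `N` telescopes: it is
`∏ i, (∑ p < N, Φ_i ^ p) (1 - Φ_i) = ∏ i, (1 - Φ_i ^ N)`, applied to the identity. -/
theorem sum_conjEnd_monomial_defect {X : ∀ i, Fin (n i) → (H →L[ℂ] H)} (hX : RowsCommute X)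
    (N : ℕ) :
    ∑ a ∈ Fintype.piFinset fun i => shortWords (n i) N, conjEnd (monomial X a) (defectMap X 1) =
      (List.ofFn fun i => (1 - rowMap (X i) ^ N : Module.End ℂ (H →L[ℂ] H))).prod 1 := by
  have h1 : ∀ a : MultiWord n, conjEnd (monomial X a) =
      (List.ofFn fun i => FreeMonoid.lift (fun j => conjEnd (X i j)) (a i)).prod := by
    intro a
    simp only [monomial, map_list_prod, List.map_ofFn, Function.comp_def, FreeMonoid.lift_apply,
      List.map_map]
  rw [← LinearMap.sum_apply, Finset.sum_congr rfl fun a _ => h1 a,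
    ← prod_ofFn_sum (fun i => shortWords (n i) N) fun i w => FreeMonoid.lift (fun j => conjEnd (X i j)) w, defectMap, ← Module.End.mul_apply,
    ← prod_ofFn_mul_of_commute]
  · congr 3
    funext i
    rw [sum_shortWords, rowMap_eq_sum_conjEnd, geom_sum_mul_neg]
  · intro i i' h
    rw [sum_shortWords, ← rowMap_eq_sum_conjEnd]
    exact Commute.sum_left _ _ _ fun p _ =>
      ((Commute.one_right _).sub_right (commute_rowMap hX h)).pow_left p

theorem tendsto_atTop_boxes (n : Fin k → ℕ) :
    Tendsto (fun N => Fintype.piFinset fun i => shortWords (n i) N) atTop atTop := by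
  apply tendsto_atTop_finset_of_monotone
  · intro N N' h a ha
    rw [Fintype.mem_piFinset] at ha ⊢
    exact fun i => mem_shortWords.2 ((mem_shortWords.1 (ha i)).trans_le h)
  · intro a
    refine ⟨∑ i, (a i).length + 1, Fintype.mem_piFinset.2 fun i => mem_shortWords.2 ?_⟩
    exact Nat.lt_succ_of_le (Finset.single_le_sum (f := fun i => (a i).length)
      (fun _ _ => Nat.zero_le _) (Finset.mem_univ i))

theorem hasSum_of_nonneg_of_tendsto {ι : Type*} {f : ι → ℝ} (hf : ∀ i, 0 ≤ f i)
    {s : ℕ → Finset ι} (hs : Tendsto s atTop atTop) {c : ℝ}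
    (h : Tendsto (fun N => ∑ i ∈ s N, f i) atTop (𝓝 c)) : HasSum f c := by
  have hsum : Summable f := by
    refine summable_of_sum_le hf (c := c) fun t => ge_of_tendsto h ?_
    filter_upwards [hs.eventually (eventually_ge_atTop t)] with N hN
    exact Finset.sum_le_sum_of_subset_of_nonneg hN fun i _ _ => hf i
  have := tendsto_nhds_unique (hsum.hasSum.comp hs) h
  exact this ▸ hsum.hasSum

/-- The Poisson kernel of a point of the polyball is an isometry: `∑ X_a Δ X_a^* = 1`, where
`Δ = D^* D` is the defect operator. -/
theorem hasSum_norm_sq_defect {X : ∀ i, Fin (n i) → (H →L[ℂ] H)} (hX : X ∈ regularPolyball n H)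
    {D : H →L[ℂ] H} (hD : defectMap X 1 = adjoint D * D) (h : H) :
    HasSum (fun a : MultiWord n => ‖D (adjoint (monomial X a) h)‖ ^ 2) (‖h‖ ^ 2) := by
  refine hasSum_of_nonneg_of_tendsto (fun a => by positivity) (tendsto_atTop_boxes n) ?_
  have h1 := tendsto_prod_one_sub_pow (fun i => rowMap (X i))
    (fun i => ‖∑ j, X i j * adjoint (X i j)‖) hX.2.1 (fun i => norm_nonneg _)
    (fun i N Y => norm_rowMap_pow_apply_le (X i) Y N) 1
  simp only [← sum_conjEnd_monomial_defect hX.1, hD] at h1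
  have h2 : Tendsto (fun N => ∑ a ∈ Fintype.piFinset fun i => shortWords (n i) N,
      RCLike.re (inner ℂ h (conjEnd (monomial X a) (adjoint D * D) h))) atTop
      (𝓝 (RCLike.re (inner ℂ h ((1 : H →L[ℂ] H) h)))) := by
    have hcont : Continuous fun T : H →L[ℂ] H => RCLike.re (inner ℂ h (T h)) := by fun_prop
    have := (hcont.tendsto _).comp h1
    simpa [Function.comp_def, sum_apply, inner_sum] using this
  rw [one_apply_eq_self, inner_self_eq_norm_sq] at h2
  refine h2.congr fun N => Finset.sum_congr rfl fun a _ => ?_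
  rw [conjEnd_apply, op_mul_apply, ← ContinuousLinearMap.adjoint_inner_left,
    op_mul_apply, op_mul_apply,
    ContinuousLinearMap.adjoint_inner_right, inner_self_eq_norm_sq]

end Poisson

/-! ### Creation operators -/

section Creation

variable {k : ℕ} (n : Fin k → ℕ)

theorem hilbertBasis_ext {ι : Type*} {H G : Type*} [NormedAddCommGroup H] [InnerProductSpace ℂ H]
    [NormedAddCommGroup G] [NormedSpace ℂ G] (b : HilbertBasis ι ℂ H) {S T : H →L[ℂ] G}
    (h : ∀ i, S (b i) = T (b i)) : S = T :=
  ContinuousLinearMap.ext_on (Submodule.dense_iff_topologicalClosure_eq_top.2 b.dense_span)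
    (by rintro _ ⟨i, rfl⟩; exact h i)

theorem commute_generator {i i' : Fin k} (h : i ≠ i') (s : Fin (n i)) (t : Fin (n i')) :
    Commute (generator i s : MultiWord n) (generator i' t) :=
  Pi.mulSingle_commute h _ _

theorem rowsCommute_creation : RowsCommute (creation n) := by
  intro i i' h s t
  apply hilbertBasis_ext (fockBasis n)
  intro a
  simp only [op_mul_apply, creation_basis, ← mul_assoc, (commute_generator n h s t).eq]

theorem monomial_creation_basis (a b : MultiWord n) :
    monomial (creation n) a (fockBasis n b) = fockBasis n (a * b) := by
  induction a using MultiWord.induction with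
  | one => simp
  | mul i j a ih =>
    rw [monomial_mul (rowsCommute_creation n), monomial_generator, op_mul_apply, ih,
      creation_basis, mul_assoc]

end Creation

/-! ### Expansion of the Poisson kernel -/

section Poisson

variable {k : ℕ} {n : Fin k → ℕ} {H : Type u} [NormedAddCommGroup H] [InnerProductSpace ℂ H]

/-- Parseval's identity. -/
theorem hasSum_norm_sq_inner {ι : Type*} (b : HilbertBasis ι ℂ H) (y : H) :
    HasSum (fun s => ‖inner ℂ (b s) y‖ ^ 2) (‖y‖ ^ 2) := by
  have h := b.hasSum_inner_mul_inner y y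
  rw [inner_self_eq_norm_sq_to_K] at h
  have h2 : (fun s => inner ℂ y (b s) * inner ℂ (b s) y) =
      fun s => ((‖inner ℂ (b s) y‖ ^ 2 : ℝ) : ℂ) := by
    funext s
    rw [← inner_conj_symm, ← Complex.normSq_eq_conj_mul_self, Complex.normSq_eq_norm_sq]
  rw [h2] at h
  refine Complex.hasSum_ofReal.1 ?_
  simpa using h

/-- Polarization of the statement that the operators `κ s` form an isometry. -/
theorem hasSum_inner_of_hasSum_norm_sq {ι : Type*} {G : Type*} [NormedAddCommGroup G]
    [InnerProductSpace ℂ G] (κ : ι → H →ₗ[ℂ] G)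
    (h : ∀ y, HasSum (fun s => ‖κ s y‖ ^ 2) (‖y‖ ^ 2)) (x y : H) :
    HasSum (fun s => inner ℂ (κ s x) (κ s y)) (inner ℂ x y) := by
  have h' : ∀ y, HasSum (fun s => ((‖κ s y‖ : ℂ)) ^ 2) ((‖y‖ : ℂ) ^ 2) := fun y => by
    exact_mod_cast Complex.hasSum_ofReal.2 (h y)
  have h1 := ((h' (x + y)).sub (h' (x - y))).add
    (((h' (x - Complex.I • y)).sub (h' (x + Complex.I • y))).mul_right Complex.I)
  have h2 := h1.div_const 4
  rw [inner_eq_sum_norm_sq_div_four x y]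
  refine Eq.subst (motive := fun f => HasSum f _) (funext fun s => ?_) h2
  rw [inner_eq_sum_norm_sq_div_four (κ s x)]
  simp

/-- The noncommutative Poisson kernel of a point `X` of the polyball, expanded along an
orthonormal basis of `H`: operators `κ s` from `H` to the Fock space that intertwine the adjoints
of `X` with those of the creation operators, and together form an isometry. -/
theorem exists_poisson_kernel [CompleteSpace H] {X : ∀ i, Fin (n i) → (H →L[ℂ] H)} (hX : X ∈ regularPolyball n H) :
    ∃ (ι : Type u) (κ : ι → H →L[ℂ] Fock n),
      (∀ s i j, adjoint (κ s) ∘L creation n i j = X i j ∘L adjoint (κ s)) ∧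
      ∀ x y, HasSum (fun s => inner ℂ (κ s x) (κ s y)) (inner ℂ x y) := by
  obtain ⟨D, hD⟩ : ∃ D : H →L[ℂ] H, defectMap X 1 = adjoint D * D :=
    CStarAlgebra.nonneg_iff_eq_star_mul_self.1
      ((ContinuousLinearMap.nonneg_iff_isPositive _).2 hX.2.2.1)
  obtain ⟨w, b, -⟩ := exists_hilbertBasis ℂ H
  have hprod : ∀ h : H, HasSum (fun p : MultiWord n × w =>
      ‖inner ℂ (b p.2) (D (adjoint (monomial X p.1) h))‖ ^ 2) (‖h‖ ^ 2) := by
    intro h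
    have h1 := hasSum_norm_sq_defect hX hD h
    have h2 := fun a : MultiWord n => hasSum_norm_sq_inner b (D (adjoint (monomial X a) h))
    have hs : Summable (fun p : MultiWord n × w =>
        ‖inner ℂ (b p.2) (D (adjoint (monomial X p.1) h))‖ ^ 2) := by
      refine (summable_prod_of_nonneg fun p => by positivity).2 ⟨fun a => (h2 a).summable, ?_⟩
      simp only [(h2 _).tsum_eq]
      exact h1.summable
    have := hs.hasSum.prod_fiberwise h2
    rw [← this.unique h1]
    exact hs.hasSum
  have hfib : ∀ (h : H) (s : w), Summable fun a : MultiWord n =>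
      ‖inner ℂ (b s) (D (adjoint (monomial X a) h))‖ ^ 2 := fun h s =>
    (hprod h).summable.prod_symm.prod_factor s
  have htot : ∀ h : H, HasSum (fun s : w => ∑' a : MultiWord n,
      ‖inner ℂ (b s) (D (adjoint (monomial X a) h))‖ ^ 2) (‖h‖ ^ 2) := fun h =>
    ((Equiv.prodComm _ _).hasSum_iff.2 (hprod h)).prod_fiberwise fun s => (hfib h s).hasSum
  have hmem : ∀ (h : H) (s : w), Memℓp (fun a : MultiWord n =>
      inner ℂ (b s) (D (adjoint (monomial X a) h))) 2 := fun h s =>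
    memℓp_gen (by simpa using hfib h s)
  -- the coordinates of `κ s h` are the coefficients of the Poisson kernel along `b s`
  let κ₀ : w → H →ₗ[ℂ] Fock n := fun s =>
    { toFun := fun h => ⟨_, hmem h s⟩
      map_add' := fun x y => by
        refine Subtype.ext (funext fun a => ?_)
        change inner ℂ (b s) (D (adjoint (monomial X a) (x + y))) =
          inner ℂ (b s) (D (adjoint (monomial X a) x)) +
            inner ℂ (b s) (D (adjoint (monomial X a) y))
        rw [map_add, map_add, inner_add_right]
      map_smul' := fun c x => by
        refine Subtype.ext (funext fun a => ?_)
        change inner ℂ (b s) (D (adjoint (monomial X a) (c • x))) =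
          c * inner ℂ (b s) (D (adjoint (monomial X a) x))
        rw [map_smul, map_smul, inner_smul_right] }
  have hκ₀ : ∀ s h a, κ₀ s h a = inner ℂ (b s) (D (adjoint (monomial X a) h)) :=
    fun s h a => rfl
  have hnorm : ∀ s h, ‖κ₀ s h‖ ^ 2 = ∑' a : MultiWord n,
      ‖inner ℂ (b s) (D (adjoint (monomial X a) h))‖ ^ 2 := by
    intro s h
    have := lp.norm_rpow_eq_tsum (p := 2) (by simp) (κ₀ s h)
    simpa [hκ₀] using this
  have hle : ∀ s h, ‖κ₀ s h‖ ≤ 1 * ‖h‖ := by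
    intro s h
    rw [one_mul]
    refine le_of_sq_le_sq ?_ (norm_nonneg _)
    rw [hnorm]
    exact le_hasSum (htot h) s fun s _ => tsum_nonneg fun a => by positivity
  let κ : w → H →L[ℂ] Fock n := fun s => (κ₀ s).mkContinuous 1 (hle s)
  refine ⟨w, κ, fun s i j => ?_, fun x y => ?_⟩
  · apply hilbertBasis_ext (fockBasis n)
    intro a
    have hbasis : ∀ a, adjoint (κ s) (fockBasis n a) = monomial X a (adjoint D (b s)) := by
      intro a
      refine ext_inner_right ℂ fun h => ?_
      rw [ContinuousLinearMap.adjoint_inner_left,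
        ← ContinuousLinearMap.adjoint_inner_right (monomial X a),
        ContinuousLinearMap.adjoint_inner_left, ← hκ₀ s h a, ← HilbertBasis.repr_apply_apply]
      rfl
    rw [ContinuousLinearMap.comp_apply, ContinuousLinearMap.comp_apply, creation_basis, hbasis,
      hbasis, monomial_mul hX.1, monomial_generator, op_mul_apply]
  · refine hasSum_inner_of_hasSum_norm_sq (fun s => (κ s).toLinearMap) (fun y => ?_) x y
    have := htot y
    simp only [← hnorm] at this
    exact this

end Poisson

/-! ### Positivity on the polyball -/

section Positivity

variable {k : ℕ} {n : Fin k → ℕ} {E : Type v} [NormedAddCommGroup E] [InnerProductSpace ℂ E]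
  {H : Type u} [NormedAddCommGroup H] [InnerProductSpace ℂ H] [CompleteSpace H]

theorem inner_monomial_mul_adjoint (X : ∀ i, Fin (n i) → (H →L[ℂ] H)) (a b : MultiWord n)
    (x y : H) : inner ℂ x ((monomial X a * adjoint (monomial X b)) y) =
      inner ℂ (adjoint (monomial X a) x) (adjoint (monomial X b) y) := by
  rw [op_mul_apply, ContinuousLinearMap.adjoint_inner_left]

/-- The matrix entries of the homogeneous parts at `X` are recovered from those at the creation
operators by means of the Poisson kernel. -/
theorem hasSum_inner_homogeneousPart {X : ∀ i, Fin (n i) → (H →L[ℂ] H)} (hX : RowsCommute X)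
    {ι : Type*} {κ : ι → H →L[ℂ] Fock n}
    (hκ : ∀ s i j, adjoint (κ s) ∘L creation n i j = X i j ∘L adjoint (κ s))
    (hκ' : ∀ x y, HasSum (fun s => inner ℂ (κ s x) (κ s y)) (inner ℂ x y))
    (A : MultiWord n → MultiWord n → (E →L[ℂ] E)) (m : Fin k → ℤ) (z z' : E ⊗[ℂ] H) :
    HasSum (fun s => inner ℂ (((κ s).toLinearMap.lTensor E z' : E ⊗[ℂ] Fock n) :
        HilbertTensor E (Fock n)) (homogeneousPart A (creation n) m
          (((κ s).toLinearMap.lTensor E z : E ⊗[ℂ] Fock n) : HilbertTensor E (Fock n))))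
      (inner ℂ (z' : HilbertTensor E H) (homogeneousPart A X m (z : HilbertTensor E H))) := by
  have hint : ∀ s a, κ s ∘L adjoint (monomial X a) =
      adjoint (monomial (creation n) a) ∘L κ s := by
    intro s a
    have := congrArg adjoint (monomial_intertwine hX (rowsCommute_creation n) (adjoint (κ s))
      (hκ s) a)
    rw [ContinuousLinearMap.adjoint_comp, ContinuousLinearMap.adjoint_comp,
      ContinuousLinearMap.adjoint_adjoint] at this
    exact this.symm
  induction z using TensorProduct.induction_on with
  | zero =>
    simp only [map_zero, tensor_coe_zero, inner_zero_right]
    exact hasSum_zero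
  | add z₁ z₂ h₁ h₂ =>
    simp only [map_add, UniformSpace.Completion.coe_add, inner_add_right]
    exact h₁.add h₂
  | tmul x y =>
    induction z' using TensorProduct.induction_on with
    | zero =>
      simp only [map_zero, tensor_coe_zero, inner_zero_left]
      exact hasSum_zero
    | add z₁ z₂ h₁ h₂ =>
      simp only [map_add, UniformSpace.Completion.coe_add, inner_add_left]
      exact h₁.add h₂
    | tmul x' y' =>
      simp only [LinearMap.lTensor_tmul, homogeneousPart, sum_apply, inner_sum,
        inner_opTensor_tmul, inner_monomial_mul_adjoint]
      refine hasSum_sum fun a _ => hasSum_sum fun b _ => HasSum.mul_left _ ?_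
      have := hκ' (adjoint (monomial X (MultiWord.ofLetters a)) y')
        (adjoint (monomial X (MultiWord.ofLetters b)) y)
      refine Eq.subst (motive := fun f => HasSum f _) (funext fun s => ?_) this
      have h1 := DFunLike.congr_fun (hint s (MultiWord.ofLetters a)) y'
      have h2 := DFunLike.congr_fun (hint s (MultiWord.ofLetters b)) y
      simp only [ContinuousLinearMap.comp_apply] at h1 h2
      rw [h1, h2]
      rfl

omit [CompleteSpace H] in
theorem summable_norm_sq_lTensor {ι : Type*} {κ : ι → H →L[ℂ] Fock n}
    (hκ : ∀ x y, HasSum (fun s => inner ℂ (κ s x) (κ s y)) (inner ℂ x y)) (z : E ⊗[ℂ] H) :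
    Summable fun s => ‖((κ s).toLinearMap.lTensor E z : E ⊗[ℂ] Fock n)‖ ^ 2 := by
  induction z using TensorProduct.induction_on with
  | zero => simp
  | add z₁ z₂ h₁ h₂ =>
    refine Summable.of_nonneg_of_le (fun s => by positivity) (fun s => ?_)
      ((h₁.add h₂).mul_left 2)
    rw [map_add]
    refine (pow_le_pow_left₀ (norm_nonneg _) (norm_add_le _ _) 2).trans ?_
    exact add_sq_le
  | tmul x y =>
    have h := ((Complex.hasSum_re (hκ y y)).summable).mul_left (‖x‖ ^ 2)
    refine h.congr fun s => ?_
    have : (inner ℂ (κ s y) (κ s y)).re = ‖κ s y‖ ^ 2 := inner_self_eq_norm_sq (𝕜 := ℂ) _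
    rw [this, LinearMap.lTensor_tmul, TensorProduct.norm_tmul, mul_pow]
    rfl

/-- Abel summation for an unconditionally convergent series with the weights `r ^ d m`. -/
theorem tendsto_tsum_pow_mul {ι : Type*} {c : ι → ℂ} (hc : Summable c) (d : ι → ℕ) :
    Tendsto (fun N : ℕ => ∑' m, (((1 - 1 / ((N : ℝ) + 1)) ^ d m : ℝ) : ℂ) * c m) atTop
      (𝓝 (∑' m, c m)) := by
  refine tendsto_tsum_of_dominated_convergence hc.norm (fun m => ?_) (Eventually.of_forall
    fun N m => ?_)
  · have h1 : Tendsto (fun N : ℕ => 1 - 1 / ((N : ℝ) + 1)) atTop (𝓝 1) := by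
      simpa using tendsto_one_div_add_atTop_nhds_zero_nat.const_sub (1 : ℝ)
    have h2 := (Complex.continuous_ofReal.tendsto _).comp (h1.pow (d m))
    simpa [Function.comp_def] using h2.mul_const (c m)
  · have h0 : (0 : ℝ) < 1 / ((N : ℝ) + 1) := by positivity
    have h1 : 1 / ((N : ℝ) + 1) ≤ 1 := by
      rw [div_le_one (by positivity)]
      linarith [(Nat.cast_nonneg N : (0 : ℝ) ≤ N)]
    rw [norm_mul, Complex.norm_real, norm_pow, Real.norm_of_nonneg (by linarith)]
    exact mul_le_of_le_one_left (norm_nonneg _) (pow_le_one₀ (by linarith) (by linarith))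

/-- A square summable family of vectors defines a normal functional `B ↦ ∑ ⟪ζ s, B (ζ s)⟫`. -/
theorem exists_hasSum_inner_apply {ι G : Type*} [NormedAddCommGroup G] [InnerProductSpace ℂ G]
    {ζ : ι → G} (hζ : Summable fun s => ‖ζ s‖ ^ 2) :
    ∃ L : (G →L[ℂ] G) →L[ℂ] ℂ, ∀ B, HasSum (fun s => inner ℂ (ζ s) (B (ζ s))) (L B) := by
  have hle : ∀ (B : G →L[ℂ] G) s, ‖inner ℂ (ζ s) (B (ζ s))‖ ≤ ‖B‖ * ‖ζ s‖ ^ 2 := fun B s => by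
    refine (norm_inner_le_norm (ζ s) (B (ζ s))).trans ?_
    nlinarith [norm_nonneg (ζ s), B.le_opNorm (ζ s)]
  have hsum : ∀ B : G →L[ℂ] G, Summable fun s => inner ℂ (ζ s) (B (ζ s)) := fun B =>
    .of_norm_bounded (hζ.mul_left ‖B‖) (hle B)
  let L : (G →L[ℂ] G) →ₗ[ℂ] ℂ :=
    { toFun := fun B => ∑' s, inner ℂ (ζ s) (B (ζ s))
      map_add' := fun B C => by
        simp only [add_apply, inner_add_right]
        exact (hsum B).tsum_add (hsum C)
      map_smul' := fun c B => by
        simp only [smul_apply, inner_smul_right]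
        exact tsum_mul_left }
  refine ⟨L.mkContinuous (∑' s, ‖ζ s‖ ^ 2) fun B => ?_, fun B => (hsum B).hasSum⟩
  rw [mul_comm, ← tsum_mul_left]
  exact tsum_of_norm_bounded (hζ.mul_left ‖B‖).hasSum (hle B)

open scoped ComplexOrder in
/-- If the sums at the dilated creation operators are positive, then so are the sums at all
points of the polyball. -/
theorem isPositive_of_seriesConverges {A : MultiWord n → MultiWord n → (E →L[ℂ] E)}
    (hA : ∀ r : ℝ, 0 ≤ r → r < 1 →
      ∃ T : HilbertTensor E (Fock n) →L[ℂ] HilbertTensor E (Fock n),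
        SeriesConverges A (fun i j => (r : ℂ) • creation n i j) T ∧ T.IsPositive)
    {X : ∀ i, Fin (n i) → (H →L[ℂ] H)} (hX : X ∈ regularPolyball n H)
    {T : HilbertTensor E H →L[ℂ] HilbertTensor E H} (hT : SeriesConverges A X T) :
    T.IsPositive := by
  obtain ⟨ι, κ, hκ, hκ'⟩ := exists_poisson_kernel hX
  refine isPositive_of_inner_nonneg fun z => ?_
  set c : (Fin k → ℤ) → ℂ := fun m =>
    inner ℂ (z : HilbertTensor E H) (homogeneousPart A X m (z : HilbertTensor E H)) with hc
  have hcT : HasSum c (inner ℂ (z : HilbertTensor E H) (T (z : HilbertTensor E H))) :=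
    HasSum.mapL (innerSL ℂ (z : HilbertTensor E H)
      ∘L ContinuousLinearMap.apply ℂ (HilbertTensor E H) (z : HilbertTensor E H)) hT
  rw [← hcT.tsum_eq]
  -- it suffices to treat the dilation by `r = 1 - 1 / (N + 1)`, whose series is a sum over `s` of
  -- matrix entries of the positive operator at the dilated creation operators
  refine ge_of_tendsto (tendsto_tsum_pow_mul hcT.summable fun m => ∑ i, (m i).natAbs)
    (Eventually.of_forall fun N => ?_)
  have h0 : (0 : ℝ) < 1 / ((N : ℝ) + 1) := by positivity
  have h1 : 1 / ((N : ℝ) + 1) ≤ 1 := by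
    rw [div_le_one (by positivity)]
    linarith [(Nat.cast_nonneg N : (0 : ℝ) ≤ N)]
  obtain ⟨S, hS, hSpos⟩ := hA (1 - 1 / ((N : ℝ) + 1)) (by linarith) (by linarith)
  let ζ : ι → HilbertTensor E (Fock n) := fun s =>
    (((κ s).toLinearMap.lTensor E z : E ⊗[ℂ] Fock n) : HilbertTensor E (Fock n))
  have hζ : Summable fun s => ‖ζ s‖ ^ 2 := by
    simpa only [ζ, UniformSpace.Completion.norm_coe] using summable_norm_sq_lTensor hκ' z
  obtain ⟨L, hL⟩ := exists_hasSum_inner_apply hζ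
  have hpart : ∀ m, L (homogeneousPart A (creation n) m) = c m := fun m =>
    (hL _).unique (hasSum_inner_homogeneousPart hX.1 hκ hκ' A m z z)
  have hfin := HasSum.mapL L hS
  simp only [homogeneousPart_smul, map_smul, hpart, smul_eq_mul] at hfin
  rw [hfin.tsum_eq]
  exact (hL S).nonneg fun s => hSpos.inner_nonneg_right _

end Positivity

/-! ### Dilated creation operators belong to the polyball -/

section PolyballMembership

variable {k : ℕ} {n : Fin k → ℕ} {H : Type u} [NormedAddCommGroup H] [InnerProductSpace ℂ H]
  [CompleteSpace H]

/-- If each `Φ i` multiplies by `P i` every operator that commutes with the `i`-th row, then the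
ordered product of the `Φ i` sends the identity to the product of the commuting operators `P i`,
which is positive and invertible as soon as they are. The last clause, that
the product commutes with whatever commutes with all the `P i`, carries the induction. -/
theorem prod_apply_one_of_commute {k : ℕ} {n : Fin k → ℕ} (Φ : Fin k → Module.End ℂ (H →L[ℂ] H))
    (P : Fin k → (H →L[ℂ] H)) (S : ∀ i, Fin (n i) → (H →L[ℂ] H))
    (hΦ : ∀ i Y, (∀ s, Commute (S i s) Y) → Φ i Y = Y * P i)
    (hSP : ∀ i j, i ≠ j → ∀ s, Commute (S i s) (P j)) (hPP : ∀ i j, i ≠ j → Commute (P i) (P j))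
    (hP : ∀ i, 0 ≤ P i) (hu : ∀ i, IsUnit (P i)) :
    0 ≤ (List.ofFn Φ).prod 1 ∧ IsUnit ((List.ofFn Φ).prod 1) ∧
      ∀ a, (∀ i, Commute a (P i)) → Commute a ((List.ofFn Φ).prod 1) := by
  induction k with
  | zero =>
    refine ⟨?_, ?_, fun a _ => ?_⟩
    · simp
    · simp
    · simp
  | succ k ih =>
    obtain ⟨h1, h2, h3⟩ := ih (fun i => Φ i.succ) (fun i => P i.succ) (fun i => S i.succ)
      (fun i => hΦ _) (fun i j h => hSP _ _ fun e => h (Fin.succ_injective _ e))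
      (fun i j h => hPP _ _ fun e => h (Fin.succ_injective _ e)) (fun i => hP _) (fun i => hu _)
    rw [List.ofFn_succ, List.prod_cons, Module.End.mul_apply,
      hΦ 0 _ fun s => h3 _ fun i => hSP _ _ (Fin.succ_ne_zero i).symm s]
    refine ⟨Commute.mul_nonneg h1 (hP 0)
      (h3 _ fun i => hPP _ _ (Fin.succ_ne_zero i).symm).symm, h2.mul (hu 0), fun a ha => ?_⟩
    exact (h3 a fun i => ha _).mul_right (ha 0)

/-- Strict dilations of doubly commuting row isometries belong to the polyball: the defect operator
is the product of the commuting positive invertible operators `1 - r² ∑ j, S i j * (S i j)^*`. -/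
theorem smul_mem_regularPolyball {S : ∀ i, Fin (n i) → (H →L[ℂ] H)}
    (hiso : ∀ i s t, adjoint (S i s) * S i t = if s = t then 1 else 0) (hS : RowsCommute S)
    (hS' : ∀ i j, i ≠ j → ∀ s t, Commute (S i s) (adjoint (S j t)))
    {r : ℝ} (h0 : 0 ≤ r) (h1 : r < 1) :
    (fun i j => (r : ℂ) • S i j) ∈ regularPolyball n H := by
  let Q : Fin k → (H →L[ℂ] H) := fun i => ∑ j, S i j * adjoint (S i j)
  have hQsa : ∀ i, IsSelfAdjoint (Q i) := fun i => by
    refine isSelfAdjoint_sum _ fun j _ => ?_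
    exact IsSelfAdjoint.mul_star_self (S i j)
  have hQQ : ∀ i, Q i * Q i = Q i := fun i => by
    simp only [Q, Finset.sum_mul_sum]
    refine Finset.sum_congr rfl fun s _ => ?_
    have : ∀ t, S i s * adjoint (S i s) * (S i t * adjoint (S i t)) =
        if s = t then S i s * adjoint (S i t) else 0 := fun t => by
      rw [mul_assoc, ← mul_assoc (adjoint (S i s)), hiso]
      split_ifs <;> simp
    simp [this]
  have hQnorm : ∀ i, ‖Q i‖ ≤ 1 := fun i => by
    have h : ‖Q i‖ = ‖Q i‖ * ‖Q i‖ := by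
      have := CStarRing.norm_star_mul_self (x := Q i)
      rwa [(hQsa i).star_eq, hQQ] at this
    nlinarith [norm_nonneg (Q i), sq_nonneg (‖Q i‖ - 1)]
  have hr2 : r ^ 2 < 1 := by nlinarith
  have hnorm : ∀ i, ‖((r ^ 2 : ℝ) : ℂ) • Q i‖ < 1 := fun i => by
    rw [norm_smul, Complex.norm_real, Real.norm_of_nonneg (by positivity)]
    nlinarith [hQnorm i, norm_nonneg (Q i), sq_nonneg r]
  have hadj : ∀ i j, adjoint ((r : ℂ) • S i j) = (r : ℂ) • adjoint (S i j) := fun i j => by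
    simp only [← ContinuousLinearMap.star_eq_adjoint, star_smul]
    simp
  have hrow : ∀ i Y, (∀ s, Commute (S i s) Y) →
      rowMap (fun j => (r : ℂ) • S i j) Y = Y * (((r ^ 2 : ℝ) : ℂ) • Q i) := fun i Y hY => by
    rw [rowMap_eq_sum_conjEnd, LinearMap.sum_apply]
    simp only [Q, Finset.smul_sum, Finset.mul_sum]
    refine Finset.sum_congr rfl fun s _ => ?_
    rw [conjEnd_apply, hadj, mul_smul_comm, mul_smul_comm, smul_mul_assoc, smul_smul,
      ← mul_assoc, (hY s).eq, mul_assoc, mul_smul_comm]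
    norm_num [sq]
  have hSQ : ∀ i j, i ≠ j → ∀ s, Commute (S i s) (Q j) := fun i j h s =>
    Commute.sum_right _ _ _ fun t _ => (hS i j h s t).mul_right (hS' i j h s t)
  have hSQ' : ∀ i j, i ≠ j → ∀ s, Commute (adjoint (S i s)) (Q j) := fun i j h s => by
    have := (hSQ i j h s).star_star
    rwa [(hQsa j).star_eq] at this
  have hQQ' : ∀ i j, i ≠ j → Commute (Q i) (Q j) := fun i j h =>
    Commute.sum_left _ _ _ fun s _ => (hSQ i j h s).mul_left (hSQ' i j h s)
  have main := prod_apply_one_of_commute (n := n)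
    (fun i => 1 - rowMap (fun j => (r : ℂ) • S i j))
    (fun i => 1 - ((r ^ 2 : ℝ) : ℂ) • Q i) S
    (fun i Y hY => by
      rw [LinearMap.sub_apply, Module.End.one_apply, hrow i Y hY, mul_sub, mul_one])
    (fun i j h s => (Commute.one_right _).sub_right ((hSQ i j h s).smul_right _))
    (fun i j h => ((Commute.one_right _).sub_right
      (((Commute.one_left _).sub_left ((hQQ' i j h).smul_left _)).smul_right _)))
    (fun i => by
      rw [sub_nonneg]
      have hsa : IsSelfAdjoint (((r ^ 2 : ℝ) : ℂ) • Q i) :=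
        IsSelfAdjoint.smul (Complex.conj_ofReal _) (hQsa i)
      refine hsa.le_algebraMap_norm_self.trans ?_
      have : algebraMap ℝ (H →L[ℂ] H) ‖((r ^ 2 : ℝ) : ℂ) • Q i‖ ≤ algebraMap ℝ (H →L[ℂ] H) 1 :=
        algebraMap_mono _ (hnorm i).le
      rwa [map_one] at this)
    (fun i => isUnit_one_sub_of_norm_lt_one (hnorm i))
  refine ⟨fun i i' h s t => ((hS i i' h s t).smul_left _).smul_right _, fun i => ?_,
    (ContinuousLinearMap.nonneg_iff_isPositive _).1 main.1, main.2.1⟩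
  have := hrow i 1 fun s => Commute.one_right _
  rw [one_mul, rowMap_eq_sum_conjEnd, LinearMap.sum_apply] at this
  simp only [conjEnd_apply, one_mul] at this
  rw [this]
  exact hnorm i

end PolyballMembership

/-! ### Relations between the creation operators -/

section CreationRelations

variable {k : ℕ} (n : Fin k → ℕ)

theorem inner_fockBasis (a b : MultiWord n) [Decidable (a = b)] :
    inner ℂ (fockBasis n a) (fockBasis n b) = if a = b then (1 : ℂ) else 0 := by
  classical
  rw [orthonormal_iff_ite.1 (fockBasis n).orthonormal a b]
  congr

theorem fock_ext_inner {f g : Fock n}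
    (h : ∀ a, inner ℂ (fockBasis n a) f = inner ℂ (fockBasis n a) g) : f = g := by
  refine (fockBasis n).repr.injective ?_
  ext a
  rw [HilbertBasis.repr_apply_apply, HilbertBasis.repr_apply_apply, h]

theorem generator_mul_apply_same {i : Fin k} (s : Fin (n i)) (a : MultiWord n) :
    (generator i s * a) i = FreeMonoid.of s * a i := by
  simp [generator]

theorem generator_mul_apply_of_ne {i i' : Fin k} (h : i' ≠ i) (s : Fin (n i)) (a : MultiWord n) :
    (generator i s * a) i' = a i' := by
  simp [generator, h]

theorem of_mul_inj {α : Type*} {s t : α} {v w : FreeMonoid α}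
    (h : FreeMonoid.of s * v = FreeMonoid.of t * w) : s = t ∧ v = w := by
  have := congrArg FreeMonoid.toList h
  simpa using this

theorem adjoint_creation_mul (i : Fin k) (s t : Fin (n i)) :
    adjoint (creation n i s) * creation n i t = if s = t then 1 else 0 := by
  classical
  apply hilbertBasis_ext (fockBasis n)
  intro b
  apply fock_ext_inner
  intro a
  rw [op_mul_apply, ContinuousLinearMap.adjoint_inner_right, creation_basis, creation_basis,
    inner_fockBasis]
  by_cases h : s = t
  · subst h
    simp [inner_fockBasis]
  · have : generator i s * a ≠ generator i t * b := fun e => h (of_mul_inj (by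
      simpa only [generator_mul_apply_same] using congrFun e i)).1
    simp [h, this]

theorem adjoint_monomial_creation_basis (a b : MultiWord n) :
    adjoint (monomial (creation n) a) (fockBasis n (a * b)) = fockBasis n b := by
  classical
  apply fock_ext_inner
  intro c
  rw [ContinuousLinearMap.adjoint_inner_right, monomial_creation_basis, inner_fockBasis,
    inner_fockBasis]
  simp

theorem adjoint_monomial_creation_basis_of_ne (a b : MultiWord n) (h : ∀ c, b ≠ a * c) :
    adjoint (monomial (creation n) a) (fockBasis n b) = 0 := by
  classical
  apply fock_ext_inner
  intro c
  rw [ContinuousLinearMap.adjoint_inner_right, monomial_creation_basis, inner_fockBasis,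
    if_neg (h c).symm, inner_zero_right]

theorem adjoint_creation_basis (i : Fin k) (s : Fin (n i)) (a : MultiWord n) :
    adjoint (creation n i s) (fockBasis n (generator i s * a)) = fockBasis n a := by
  rw [← monomial_generator (X := creation n), adjoint_monomial_creation_basis]

theorem adjoint_creation_basis_of_ne (i : Fin k) (s : Fin (n i)) (b : MultiWord n)
    (h : ∀ a, b ≠ generator i s * a) : adjoint (creation n i s) (fockBasis n b) = 0 := by
  rw [← monomial_generator (X := creation n), adjoint_monomial_creation_basis_of_ne n _ _ h]

/-- Creation operators acting on different tensor factors doubly commute. -/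
theorem commute_creation_adjoint (i i' : Fin k) (h : i ≠ i') (s : Fin (n i)) (t : Fin (n i')) :
    Commute (creation n i s) (adjoint (creation n i' t)) := by
  apply hilbertBasis_ext (fockBasis n)
  intro b
  rw [op_mul_apply, op_mul_apply, creation_basis]
  by_cases hb : ∃ a, b = generator i' t * a
  · obtain ⟨a, rfl⟩ := hb
    rw [adjoint_creation_basis, creation_basis, ← mul_assoc, (commute_generator n h s t).eq,
      mul_assoc, adjoint_creation_basis]
  · push Not at hb
    rw [adjoint_creation_basis_of_ne n i' t b hb, map_zero, adjoint_creation_basis_of_ne]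
    intro a e
    refine hb (Function.update b i' (a i')) ?_
    funext l
    by_cases hl : l = i'
    · subst hl
      have := congrFun e l
      rw [generator_mul_apply_of_ne n h.symm, generator_mul_apply_same] at this
      rw [generator_mul_apply_same, this, Function.update_self]
    · rw [generator_mul_apply_of_ne n hl, Function.update_of_ne hl]

/-- Dilated creation operators, transported to any Hilbert space that is isomorphic to the Fock
space, belong to the polyball. -/
theorem smul_conj_creation_mem_regularPolyball {H : Type u} [NormedAddCommGroup H]
    [InnerProductSpace ℂ H] [CompleteSpace H] (U : Fock n ≃ₗᵢ[ℂ] H) {r : ℝ} (h0 : 0 ≤ r)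
    (h1 : r < 1) :
    (fun i j => (r : ℂ) • U.conjStarAlgEquiv (creation n i j)) ∈ regularPolyball n H := by
  refine smul_mem_regularPolyball (fun i s t => ?_) (fun i i' h s t => ?_)
    (fun i i' h s t => ?_) h0 h1
  · have := congrArg U.conjStarAlgEquiv (adjoint_creation_mul n i s t)
    rw [← ContinuousLinearMap.star_eq_adjoint, map_mul, map_star,
      ContinuousLinearMap.star_eq_adjoint] at this
    rw [this]
    split_ifs <;> simp
  · exact (rowsCommute_creation n i i' h s t).map U.conjStarAlgEquiv
  · have := (commute_creation_adjoint n i i' h s t).map U.conjStarAlgEquiv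
    rwa [← ContinuousLinearMap.star_eq_adjoint, map_star] at this

/-- A copy of the Fock space in an arbitrary universe. -/
theorem exists_fock_equiv : ∃ (H : Type u) (_ : NormedAddCommGroup H) (_ : InnerProductSpace ℂ H)
    (_ : CompleteSpace H), Nonempty (Fock n ≃ₗᵢ[ℂ] H) := by
  refine ⟨lp (fun _ : ULift.{u} (MultiWord n) => ℂ) 2, inferInstance, inferInstance,
    inferInstance, ⟨(HilbertBasis.mk (v := fun a : ULift.{u} (MultiWord n) => fockBasis n a.down)
      ((fockBasis n).orthonormal.comp _ ULift.down_injective) ?_).repr⟩⟩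
  have : Set.range (fun a : ULift.{u} (MultiWord n) => fockBasis n a.down) =
      Set.range (fockBasis n) := ULift.down_surjective.range_comp _
  rw [this, (fockBasis n).dense_span]

end CreationRelations

/-! ### The multi-Toeplitz kernel of a pluriharmonic function -/

section Kernel

variable {k : ℕ} {n : Fin k → ℕ}

/-- A pair of tuples of words is reduced if, in each coordinate, at least one of the two words is
empty. -/
def IsReduced (a b : MultiWord n) : Prop := ∀ i, a i = 1 ∨ b i = 1

theorem mul_of_inj {α : Type*} {s t : α} {v w : FreeMonoid α}
    (h : v * FreeMonoid.of s = w * FreeMonoid.of t) : v = w ∧ s = t := by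
  have := congrArg FreeMonoid.toList h
  simp only [FreeMonoid.toList_mul, FreeMonoid.toList_of] at this
  obtain ⟨h1, h2⟩ := List.append_inj' this rfl
  exact ⟨FreeMonoid.toList.injective h1, by simpa using h2⟩

theorem mul_inj_of_length_eq {α : Type*} {u v u' v' : FreeMonoid α} (h : u * v = u' * v')
    (hl : u.length = u'.length) : u = u' := by
  have := congrArg FreeMonoid.toList h
  simp only [FreeMonoid.toList_mul] at this
  exact FreeMonoid.toList.injective (List.append_inj this hl).1

/-- Cancelling the largest common suffixes of two tuples of words is unambiguous. -/
theorem IsReduced.unique {a b a' b' c c' : MultiWord n} (h : IsReduced a b) (h' : IsReduced a' b')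
    (ha : a * c = a' * c') (hb : b * c = b' * c') : a = a' ∧ b = b' := by
  have key : ∀ i, (a i).length = (a' i).length ∧ (b i).length = (b' i).length := by
    intro i
    have e1 := congrArg FreeMonoid.length (congrFun ha i)
    have e2 := congrArg FreeMonoid.length (congrFun hb i)
    simp only [Pi.mul_apply, FreeMonoid.length_mul] at e1 e2
    have r := (h i).imp (congrArg FreeMonoid.length) (congrArg FreeMonoid.length)
    have r' := (h' i).imp (congrArg FreeMonoid.length) (congrArg FreeMonoid.length)
    simp only [FreeMonoid.length_one] at r r'
    omega
  exact ⟨funext fun i => mul_inj_of_length_eq (congrFun ha i) (key i).1,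
    funext fun i => mul_inj_of_length_eq (congrFun hb i) (key i).2⟩

variable {E : Type v} [NormedAddCommGroup E] [InnerProductSpace ℂ E]

open Classical in
/-- The multi-Toeplitz kernel with coefficients `A`: its entry at `(a * c, b * c)`, with `(a, b)`
reduced, is `A a b`; all the other entries vanish. -/
def toeplitz (A : MultiWord n → MultiWord n → (E →L[ℂ] E)) :
    Matrix (MultiWord n) (MultiWord n) (E →L[ℂ] E) := fun σ ω =>
  if h : ∃ p : MultiWord n × MultiWord n, IsReduced p.1 p.2 ∧ ∃ c, σ = p.1 * c ∧ ω = p.2 * c then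
    A h.choose.1 h.choose.2 else 0

variable (A : MultiWord n → MultiWord n → (E →L[ℂ] E))

theorem toeplitz_mul {a b : MultiWord n} (h : IsReduced a b) (c : MultiWord n) :
    toeplitz A (a * c) (b * c) = A a b := by
  have hex : ∃ p : MultiWord n × MultiWord n,
      IsReduced p.1 p.2 ∧ ∃ c', a * c = p.1 * c' ∧ b * c = p.2 * c' := ⟨(a, b), h, c, rfl, rfl⟩
  rw [toeplitz, dif_pos hex]
  obtain ⟨hr, c', h1, h2⟩ := hex.choose_spec
  obtain ⟨e1, e2⟩ := h.unique hr h1 h2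
  rw [← e1, ← e2]

theorem toeplitz_apply_of_isReduced {a b : MultiWord n} (h : IsReduced a b) :
    toeplitz A a b = A a b := by
  simpa using toeplitz_mul A h 1

theorem toeplitz_eq_zero {σ ω : MultiWord n}
    (h : ∀ a b c, IsReduced a b → σ = a * c → ω ≠ b * c) : toeplitz A σ ω = 0 := by
  rw [toeplitz, dif_neg]
  rintro ⟨p, hp, c, h1, h2⟩
  exact h _ _ _ hp h1 h2

theorem mul_generator_apply_same (i : Fin k) (s : Fin (n i)) (a : MultiWord n) :
    (a * generator i s) i = a i * FreeMonoid.of s := by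
  simp [generator]

/-- The kernel is invariant under right multiplication of both indices by a generator; hence the
shifts of kernel functions are isometric. -/
theorem toeplitz_mul_generator (i : Fin k) (s : Fin (n i)) (σ ω : MultiWord n) :
    toeplitz A (σ * generator i s) (ω * generator i s) = toeplitz A σ ω := by
  by_cases h : ∃ a b c, IsReduced a b ∧ σ = a * c ∧ ω = b * c
  · obtain ⟨a, b, c, hr, rfl, rfl⟩ := h
    rw [mul_assoc, mul_assoc, toeplitz_mul A hr, toeplitz_mul A hr]
  · rw [toeplitz_eq_zero A fun a b c hr h1 h2 => h ⟨a, b, c, hr, h1, h2⟩]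
    refine toeplitz_eq_zero A fun a b c hr h1 h2 => h ?_
    -- one of `a i`, `b i` is empty, so the common suffix `c i` ends in the letter `s`
    obtain ⟨x, hx⟩ : ∃ x, c i = x * FreeMonoid.of s := by
      have e1 := congrFun h1 i
      have e2 := congrFun h2 i
      rw [mul_generator_apply_same, Pi.mul_apply] at e1 e2
      rcases hr i with hi | hi
      · exact ⟨σ i, by rw [e1, hi, one_mul]⟩
      · exact ⟨ω i, by rw [e2, hi, one_mul]⟩
    have hc : c = Function.update c i x * generator i s := by
      funext l
      by_cases hl : l = i
      · subst hl
        rw [mul_generator_apply_same, Function.update_self, hx]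
      · simp [generator, hl]
    refine ⟨a, b, Function.update c i x, hr, ?_, ?_⟩
    · rw [hc, ← mul_assoc] at h1
      exact mul_right_cancel h1
    · rw [hc, ← mul_assoc] at h2
      exact mul_right_cancel h2

/-- Indices whose `i`-th words end in different letters are orthogonal; hence the shifts by
different generators of the same row have orthogonal ranges. -/
theorem toeplitz_mul_generator_of_ne (i : Fin k) {s t : Fin (n i)} (hst : s ≠ t)
    (σ ω : MultiWord n) : toeplitz A (σ * generator i s) (ω * generator i t) = 0 := by
  refine toeplitz_eq_zero A fun a b c hr h1 h2 => hst ?_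
  have e1 := congrFun h1 i
  have e2 := congrFun h2 i
  rw [mul_generator_apply_same, Pi.mul_apply] at e1 e2
  rcases hr i with hi | hi
  · rw [hi, one_mul] at e1
    rw [← e1, ← mul_assoc] at e2
    exact (mul_of_inj e2).2.symm
  · rw [hi, one_mul] at e2
    rw [← e2, ← mul_assoc] at e1
    exact (mul_of_inj e1).2

theorem isReduced_ofLetters {m : Fin k → ℤ} (a : ∀ i, Fin (-m i).toNat → Fin (n i))
    (b : ∀ i, Fin (m i).toNat → Fin (n i)) :
    IsReduced (MultiWord.ofLetters a) (MultiWord.ofLetters b) := by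
  intro i
  have h1 := MultiWord.length_ofLetters_apply a i
  have h2 := MultiWord.length_ofLetters_apply b i
  rcases le_total (m i) 0 with h | h
  · exact Or.inr (FreeMonoid.length_eq_zero.1 (by omega))
  · exact Or.inl (FreeMonoid.length_eq_zero.1 (by omega))

/-- The homogeneous parts only depend on the coefficients at reduced pairs. -/
theorem homogeneousPart_congr {H : Type u} [NormedAddCommGroup H] [InnerProductSpace ℂ H]
    [CompleteSpace H] {A B : MultiWord n → MultiWord n → (E →L[ℂ] E)}
    (h : ∀ a b, IsReduced a b → A a b = B a b) (X : ∀ i, Fin (n i) → (H →L[ℂ] H)) :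
    homogeneousPart A X = homogeneousPart B X := by
  funext m
  exact Finset.sum_congr rfl fun a _ => Finset.sum_congr rfl fun b _ => by
    rw [h _ _ (isReduced_ofLetters a b)]

theorem SeriesConverges.congr {H : Type u} [NormedAddCommGroup H] [InnerProductSpace ℂ H]
    [CompleteSpace H] {A B : MultiWord n → MultiWord n → (E →L[ℂ] E)}
    (h : ∀ a b, IsReduced a b → A a b = B a b) {X : ∀ i, Fin (n i) → (H →L[ℂ] H)}
    {T : HilbertTensor E H →L[ℂ] HilbertTensor E H} (hT : SeriesConverges A X T) :
    SeriesConverges B X T := by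
  rw [SeriesConverges, homogeneousPart_congr h] at hT
  exact hT

/-- The multi-degree of the only homogeneous part with a nonzero matrix entry at `(σ, ω)`. -/
def entryDegree (σ ω : MultiWord n) (i : Fin k) : ℤ := (ω i).length - (σ i).length

open Classical in
theorem inner_monomial_creation (a b σ ω : MultiWord n) :
    inner ℂ (fockBasis n σ) ((monomial (creation n) a * adjoint (monomial (creation n) b))
      (fockBasis n ω)) = if ∃ c, σ = a * c ∧ ω = b * c then (1 : ℂ) else 0 := by
  rw [inner_monomial_mul_adjoint]
  by_cases ha : ∃ c, σ = a * c
  · by_cases hb : ∃ c, ω = b * c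
    · obtain ⟨c, rfl⟩ := ha
      obtain ⟨c', rfl⟩ := hb
      rw [adjoint_monomial_creation_basis, adjoint_monomial_creation_basis, inner_fockBasis]
      simp [eq_comm]
    · rw [adjoint_monomial_creation_basis_of_ne n b ω fun c hc => hb ⟨c, hc⟩, inner_zero_right,
        if_neg fun ⟨c, hc⟩ => hb ⟨c, hc.2⟩]
  · rw [adjoint_monomial_creation_basis_of_ne n a σ fun c hc => ha ⟨c, hc⟩, inner_zero_left,
      if_neg fun ⟨c, hc⟩ => ha ⟨c, hc.1⟩]

open Classical in
/-- The matrix entries of the homogeneous parts at the creation operators. -/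
theorem inner_homogeneousPart_creation (m : Fin k → ℤ) (x y : E) (σ ω : MultiWord n) :
    inner ℂ ((y ⊗ₜ[ℂ] fockBasis n σ : E ⊗[ℂ] Fock n) : HilbertTensor E (Fock n))
      (homogeneousPart A (creation n) m
        ((x ⊗ₜ[ℂ] fockBasis n ω : E ⊗[ℂ] Fock n) : HilbertTensor E (Fock n))) =
      if m = entryDegree σ ω then inner ℂ y (toeplitz A σ ω x) else 0 := by
  simp only [homogeneousPart, sum_apply, inner_sum, inner_opTensor_tmul, inner_monomial_creation]
  have hdeg : ∀ (a : ∀ i, Fin (-m i).toNat → Fin (n i)) (b : ∀ i, Fin (m i).toNat → Fin (n i)),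
      (∃ c, σ = MultiWord.ofLetters a * c ∧ ω = MultiWord.ofLetters b * c) →
      m = entryDegree σ ω := by
    rintro a b ⟨c, rfl, rfl⟩
    funext i
    simp only [entryDegree, Pi.mul_apply, FreeMonoid.length_mul,
      MultiWord.length_ofLetters_apply]
    omega
  split_ifs with hm
  · by_cases hex : ∃ a b c, IsReduced a b ∧ σ = a * c ∧ ω = b * c
    · obtain ⟨a, b, c, hr, rfl, rfl⟩ := hex
      have hlen : ∀ i, (a i).length = (-m i).toNat ∧ (b i).length = (m i).toNat := by
        intro i
        rw [hm]
        simp only [entryDegree, Pi.mul_apply, FreeMonoid.length_mul]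
        have r := (hr i).imp (congrArg FreeMonoid.length) (congrArg FreeMonoid.length)
        simp only [FreeMonoid.length_one] at r
        omega
      obtain ⟨a₀, rfl⟩ := MultiWord.exists_ofLetters fun i => (hlen i).1
      obtain ⟨b₀, rfl⟩ := MultiWord.exists_ofLetters fun i => (hlen i).2
      rw [toeplitz_mul A hr, Finset.sum_eq_single a₀, Finset.sum_eq_single b₀,
        if_pos ⟨c, rfl, rfl⟩, mul_one]
      · intro b' _ hb'
        rw [if_neg, mul_zero]
        rintro ⟨c', h1, h2⟩
        exact hb' (MultiWord.ofLetters_injective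
          (hr.unique (isReduced_ofLetters a₀ b') h1 h2).2).symm
      · simp
      · intro a' _ ha'
        refine Finset.sum_eq_zero fun b' _ => ?_
        rw [if_neg, mul_zero]
        rintro ⟨c', h1, h2⟩
        exact ha' (MultiWord.ofLetters_injective
          (hr.unique (isReduced_ofLetters a' b') h1 h2).1).symm
      · simp
    · rw [toeplitz_eq_zero A fun a b c hr h1 h2 => hex ⟨a, b, c, hr, h1, h2⟩, zero_apply,
        inner_zero_right]
      refine Finset.sum_eq_zero fun a _ => Finset.sum_eq_zero fun b _ => ?_
      rw [if_neg, mul_zero]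
      rintro ⟨c, h1, h2⟩
      exact hex ⟨_, _, c, isReduced_ofLetters a b, h1, h2⟩
  · refine Finset.sum_eq_zero fun a _ => Finset.sum_eq_zero fun b _ => ?_
    rw [if_neg fun h => hm (hdeg a b h), mul_zero]

variable {A}

/-- The matrix entries of the sum of the series at the dilated creation operators. -/
theorem SeriesConverges.inner_fockBasis {r : ℝ}
    {T : HilbertTensor E (Fock n) →L[ℂ] HilbertTensor E (Fock n)}
    (hT : SeriesConverges A (fun i j => (r : ℂ) • creation n i j) T) (x y : E)
    (σ ω : MultiWord n) :
    inner ℂ ((y ⊗ₜ[ℂ] fockBasis n σ : E ⊗[ℂ] Fock n) : HilbertTensor E (Fock n))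
      (T ((x ⊗ₜ[ℂ] fockBasis n ω : E ⊗[ℂ] Fock n) : HilbertTensor E (Fock n))) =
      ((r ^ ∑ i, (entryDegree σ ω i).natAbs : ℝ) : ℂ) * inner ℂ y (toeplitz A σ ω x) := by
  have h := HasSum.mapL (innerSL ℂ ((y ⊗ₜ[ℂ] fockBasis n σ : E ⊗[ℂ] Fock n) :
      HilbertTensor E (Fock n)) ∘L ContinuousLinearMap.apply ℂ (HilbertTensor E (Fock n))
        ((x ⊗ₜ[ℂ] fockBasis n ω : E ⊗[ℂ] Fock n) : HilbertTensor E (Fock n))) hT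
  refine h.unique ?_
  have hs := hasSum_single (f := fun m => innerSL ℂ ((y ⊗ₜ[ℂ] fockBasis n σ : E ⊗[ℂ] Fock n) :
      HilbertTensor E (Fock n)) (homogeneousPart A (fun i j => (r : ℂ) • creation n i j) m
        ((x ⊗ₜ[ℂ] fockBasis n ω : E ⊗[ℂ] Fock n) : HilbertTensor E (Fock n))))
    (entryDegree σ ω) fun m hm => by
      rw [homogeneousPart_smul, smul_apply, innerSL_apply_apply, inner_smul_right,
        inner_homogeneousPart_creation, if_neg hm, mul_zero]
  rwa [homogeneousPart_smul, smul_apply, innerSL_apply_apply, inner_smul_right,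
    inner_homogeneousPart_creation, if_pos rfl] at hs

variable [CompleteSpace E]

theorem isHermitian_toeplitz (h : ∀ r : ℝ, 0 ≤ r → r < 1 →
      ∃ T : HilbertTensor E (Fock n) →L[ℂ] HilbertTensor E (Fock n),
        SeriesConverges A (fun i j => (r : ℂ) • creation n i j) T ∧ T.IsPositive) :
    (toeplitz A).IsHermitian := by
  obtain ⟨T, hT, hpos⟩ := h (1 / 2) (by norm_num) (by norm_num)
  refine Matrix.IsHermitian.ext fun σ ω => ?_
  refine ContinuousLinearMap.ext fun x => ext_inner_left ℂ fun y => ?_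
  rw [ContinuousLinearMap.star_eq_adjoint, ContinuousLinearMap.adjoint_inner_right]
  have h1 := hT.inner_fockBasis x y σ ω
  have h2 := hT.inner_fockBasis y x ω σ
  have h3 : ∑ i, (entryDegree ω σ i).natAbs = ∑ i, (entryDegree σ ω i).natAbs :=
    Finset.sum_congr rfl fun i _ => by simp only [entryDegree]; omega
  have h4 := congrArg (starRingEnd ℂ) h2
  rw [h3, inner_conj_symm, map_mul, inner_conj_symm, Complex.conj_ofReal] at h4
  rw [← ContinuousLinearMap.coe_coe T, ← hpos.isSymmetric, ContinuousLinearMap.coe_coe, h4] at h1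
  exact mul_left_cancel₀ (Complex.ofReal_ne_zero.2 (by positivity)) h1

/-- The multi-Toeplitz kernel of a positive pluriharmonic function is positive semidefinite: it is
the entrywise limit of the matrices of the values at the dilated creation operators. -/
theorem posSemidef_toeplitz (h : ∀ r : ℝ, 0 ≤ r → r < 1 →
      ∃ T : HilbertTensor E (Fock n) →L[ℂ] HilbertTensor E (Fock n),
        SeriesConverges A (fun i j => (r : ℂ) • creation n i j) T ∧ T.IsPositive) :
    (toeplitz A).PosSemidef := by
  have key := (RKHS.posSemidef_tfae (K := toeplitz A)).out 0 2
  refine key.2 ⟨isHermitian_toeplitz h, fun f => ?_⟩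
  let d : MultiWord n → MultiWord n → ℕ := fun σ ω => ∑ i, (entryDegree σ ω i).natAbs
  have hlim : Tendsto (fun N : ℕ => ∑ ω ∈ f.support, ∑ σ ∈ f.support,
      (1 - 1 / ((N : ℝ) + 1)) ^ d σ ω * RCLike.re (inner ℂ (f σ) (toeplitz A σ ω (f ω)))) atTop
      (𝓝 (∑ ω ∈ f.support, ∑ σ ∈ f.support,
        RCLike.re (inner ℂ (f σ) (toeplitz A σ ω (f ω))))) := by
    refine tendsto_finsetSum _ fun ω _ => tendsto_finsetSum _ fun σ _ => ?_
    have h1 : Tendsto (fun N : ℕ => 1 - 1 / ((N : ℝ) + 1)) atTop (𝓝 1) := by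
      simpa using tendsto_one_div_add_atTop_nhds_zero_nat.const_sub (1 : ℝ)
    simpa using (h1.pow (d σ ω)).mul_const
      (RCLike.re (inner ℂ (f σ) (toeplitz A σ ω (f ω))))
  have hnonneg : 0 ≤ ∑ ω ∈ f.support, ∑ σ ∈ f.support,
        RCLike.re (inner ℂ (f σ) (toeplitz A σ ω (f ω))) := by
    refine ge_of_tendsto hlim (Eventually.of_forall fun N => ?_)
    have h0 : (0 : ℝ) < 1 / ((N : ℝ) + 1) := by positivity
    have h1 : 1 / ((N : ℝ) + 1) ≤ 1 := by
      rw [div_le_one (by positivity)]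
      linarith [(Nat.cast_nonneg N : (0 : ℝ) ≤ N)]
    obtain ⟨T, hT, hpos⟩ := h (1 - 1 / ((N : ℝ) + 1)) (by linarith) (by linarith)
    have := hpos.re_inner_nonneg_right (∑ ω ∈ f.support,
      ((f ω ⊗ₜ[ℂ] fockBasis n ω : E ⊗[ℂ] Fock n) : HilbertTensor E (Fock n)))
    rw [map_sum, inner_sum] at this
    simp only [sum_inner, hT.inner_fockBasis, map_sum] at this
    refine this.trans_eq (Finset.sum_congr rfl fun ω _ => Finset.sum_congr rfl fun σ _ => ?_)
    exact RCLike.re_ofReal_mul _ _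
  refine hnonneg.trans_eq ?_
  simp only [Finsupp.sum, map_sum]
  exact Finset.sum_congr rfl fun ω _ => Finset.sum_congr rfl fun σ _ => inner_re_symm _ _

end Kernel

/-! ### The isometric dilation -/

section Dilation

/-- Families with the same Gram matrix, the first of which is total, are related by an operator. -/
theorem exists_continuousLinearMap_of_inner_eq {J K G : Type*} [NormedAddCommGroup K]
    [InnerProductSpace ℂ K] [NormedAddCommGroup G] [InnerProductSpace ℂ G] [CompleteSpace G]
    {f : J → K} (g : J → G)
    (hf : Dense (Submodule.span ℂ (Set.range f) : Set K))
    (h : ∀ a b, inner ℂ (g a) (g b) = inner ℂ (f a) (f b)) :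
    ∃ V : K →L[ℂ] G, ∀ a, V (f a) = g a := by
  have hnorm : ∀ c : J →₀ ℂ, ‖Finsupp.linearCombination ℂ g c‖ ≤
      1 * ‖Finsupp.linearCombination ℂ f c‖ := fun c => by
    rw [one_mul, norm_eq_sqrt_re_inner (𝕜 := ℂ), norm_eq_sqrt_re_inner (𝕜 := ℂ)]
    simp only [Finsupp.linearCombination_apply, Finsupp.sum, sum_inner, inner_sum,
      inner_smul_left, inner_smul_right, h]
    exact le_rfl
  have hdense : DenseRange (Finsupp.linearCombination ℂ f) := by
    rwa [DenseRange, ← LinearMap.coe_range, Finsupp.range_linearCombination]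
  refine ⟨(Finsupp.linearCombination ℂ g).extendOfNorm (Finsupp.linearCombination ℂ f),
    fun a => ?_⟩
  have := LinearMap.extendOfNorm_eq hdense ⟨1, hnorm⟩ (Finsupp.single a (1 : ℂ))
  simpa using this

variable {k : ℕ} {n : Fin k → ℕ}

theorem MultiWord.rev_rev (a : MultiWord n) : a.rev.rev = a :=
  funext fun _ => FreeMonoid.reverse_reverse

theorem MultiWord.rev_generator_mul (i : Fin k) (s : Fin (n i)) (a : MultiWord n) :
    (generator i s * a).rev = a.rev * generator i s := by
  funext l
  by_cases hl : l = i
  · subst hl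
    simp [MultiWord.rev, generator, FreeMonoid.reverse_mul]
  · simp [MultiWord.rev, generator, hl]

open RKHS in
/-- A positive semidefinite multi-Toeplitz kernel with `toeplitz A 1 1 = 1` comes from commuting
row isometries `V` on its reproducing kernel Hilbert space: `V i s` maps the kernel function at
`ω` to the one at `ω * generator i s`. -/
theorem exists_commutingRowIsometries {E : Type v} [NormedAddCommGroup E]
    [InnerProductSpace ℂ E] [CompleteSpace E]
    {A : MultiWord n → MultiWord n → (E →L[ℂ] E)} (hpos : (toeplitz A).PosSemidef)
    (hone : toeplitz A 1 1 = 1) :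
    ∃ (K : Type v) (_ : NormedAddCommGroup K) (_ : InnerProductSpace ℂ K) (_ : CompleteSpace K)
      (ι : E →ₗᵢ[ℂ] K) (V : ∀ i, Fin (n i) → (K →L[ℂ] K)),
      IsCommutingRowIsometries V ∧ ∀ a b, compressionCoeff ι V a b = toeplitz A a b := by
  have : Fact (toeplitz A).PosSemidef := ⟨hpos⟩
  let K := OfKernel (toeplitz A)
  have hin : ∀ σ ω (x y : E), inner ℂ (kerFun K σ y) (kerFun K ω x) =
      inner ℂ y (toeplitz A σ ω x) := fun σ ω x y => by
    rw [kerFun_inner, kerFun_apply, OfKernel.kernel_ofKernel]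
  have hdense : Dense (Submodule.span ℂ (Set.range fun p : MultiWord n × E =>
      kerFun K p.1 p.2) : Set K) := by
    rw [Submodule.dense_iff_topologicalClosure_eq_top, ← kerFun_dense K]
    congr 2
    ext f
    simp
  have hext : ∀ {S T : K →L[ℂ] K}, (∀ ω x, S (kerFun K ω x) = T (kerFun K ω x)) → S = T :=
    fun h => ContinuousLinearMap.ext_on hdense (by rintro _ ⟨p, rfl⟩; exact h p.1 p.2)
  have hvec : ∀ {f g : K}, (∀ σ y, inner ℂ (kerFun K σ y) f = inner ℂ (kerFun K σ y) g) →
      f = g := fun h => RKHS.ext fun σ => ext_inner_left ℂ fun y => by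
    simpa only [kerFun_inner] using h σ y
  have hV : ∀ i (s : Fin (n i)), ∃ V : K →L[ℂ] K, ∀ p : MultiWord n × E,
      V (kerFun K p.1 p.2) = kerFun K (p.1 * generator i s) p.2 := fun i s =>
    exists_continuousLinearMap_of_inner_eq _ hdense fun p q => by
      rw [hin, hin, toeplitz_mul_generator]
  choose V hV using hV
  have hV' : ∀ i s ω x, V i s (kerFun K ω x) = kerFun K (ω * generator i s) x :=
    fun i s ω x => hV i s (ω, x)
  have hcomm : RowsCommute V := fun i i' h s t => hext fun ω x => by
    rw [op_mul_apply, op_mul_apply, hV', hV', hV', hV', mul_assoc, mul_assoc,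
      (commute_generator n h s t).eq]
  have hmon : ∀ a x, monomial V a (kerFun K 1 x) = kerFun K a.rev x := by
    intro a x
    induction a using MultiWord.induction with
    | one => rw [monomial_one]; rfl
    | mul i s a ih =>
      rw [monomial_mul hcomm, monomial_generator, op_mul_apply, ih, hV',
        MultiWord.rev_generator_mul]
  let ι : E →ₗᵢ[ℂ] K := (kerFun K 1).toLinearMap.isometryOfInner fun x y => by
    rw [ContinuousLinearMap.coe_coe, hin, hone]; rfl
  have hι : ∀ x, ι.toContinuousLinearMap x = kerFun K 1 x := fun x => rfl
  refine ⟨K, inferInstance, inferInstance, inferInstance, ι, V, ⟨fun i s t => ?_, hcomm⟩,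
    fun a b => ?_⟩
  · refine hext fun ω x => hvec fun σ y => ?_
    rw [op_mul_apply, ContinuousLinearMap.adjoint_inner_right, hV', hV', hin]
    split_ifs with h
    · subst h
      rw [toeplitz_mul_generator, one_apply_eq_self, hin]
    · rw [toeplitz_mul_generator_of_ne A i h]
      simp
  · refine ContinuousLinearMap.ext fun x => ext_inner_left ℂ fun y => ?_
    rw [compressionCoeff, ContinuousLinearMap.comp_apply, ContinuousLinearMap.comp_apply,
      ContinuousLinearMap.adjoint_inner_right, op_mul_apply,
      ContinuousLinearMap.adjoint_inner_right, hι, hι, hmon, hmon, hin, MultiWord.rev_rev,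
      MultiWord.rev_rev]

/-- The values of a positive pluriharmonic function at the dilated creation operators, on the Fock
space itself. -/
theorem exists_seriesConverges_creation {E : Type v} [NormedAddCommGroup E]
    [InnerProductSpace ℂ E] {F : PolyballMap.{u, v} n E} (hpos : IsPositiveMap F)
    {A : MultiWord n → MultiWord n → (E →L[ℂ] E)}
    (hA : ∀ (H : Type u) [NormedAddCommGroup H] [InnerProductSpace ℂ H] [CompleteSpace H]
      (X : regularPolyball n H), SeriesConverges A X.1 (F H X).1) (r : ℝ) (h0 : 0 ≤ r)
    (h1 : r < 1) :
    ∃ T : HilbertTensor E (Fock n) →L[ℂ] HilbertTensor E (Fock n),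
      SeriesConverges A (fun i j => (r : ℂ) • creation n i j) T ∧ T.IsPositive := by
  obtain ⟨H, _, _, _, ⟨U⟩⟩ := exists_fock_equiv.{u} n
  let X : regularPolyball n H := ⟨_, smul_conj_creation_mem_regularPolyball n U h0 h1⟩
  refine ⟨_, ?_, isPositive_conj (tensorUnitary E U.symm) (hpos H X)⟩
  have := (hA H X).conj U.symm
  convert this using 1
  funext i j
  rw [show X.1 i j = (r : ℂ) • U.conjStarAlgEquiv (creation n i j) from rfl, map_smul,
    ← LinearIsometryEquiv.symm_conjStarAlgEquiv, StarAlgEquiv.symm_apply_apply]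

/-- The normalization `F(0) = 1`, read off from the value at the zero dilation of the creation
operators. -/
theorem toeplitz_one_one {E : Type v} [NormedAddCommGroup E]
    [InnerProductSpace ℂ E] {F : PolyballMap.{u, v} n E}
    (hF : ∀ (H : Type u) [NormedAddCommGroup H] [InnerProductSpace ℂ H] [CompleteSpace H],
      (F H 0 : HilbertTensor E H →L[ℂ] HilbertTensor E H) = 1)
    {A : MultiWord n → MultiWord n → (E →L[ℂ] E)}
    (hA : ∀ (H : Type u) [NormedAddCommGroup H] [InnerProductSpace ℂ H] [CompleteSpace H]
      (X : regularPolyball n H), SeriesConverges A X.1 (F H X).1) :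
    toeplitz A 1 1 = 1 := by
  obtain ⟨H, _, _, _, ⟨U⟩⟩ := exists_fock_equiv.{u} n
  have h := (hA H 0).conj U.symm
  rw [hF, map_one] at h
  have h' : SeriesConverges A (fun i j => ((0 : ℝ) : ℂ) • creation n i j)
      (1 : HilbertTensor E (Fock n) →L[ℂ] HilbertTensor E (Fock n)) := by
    convert h using 1
    funext i j
    rw [show (0 : regularPolyball n H).1 i j = 0 from rfl]
    simp
  refine ContinuousLinearMap.ext fun x => ext_inner_left ℂ fun y => ?_
  have := h'.inner_fockBasis x y 1 1
  rw [one_apply_eq_self, UniformSpace.Completion.inner_coe, TensorProduct.inner_tmul,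
    inner_self_eq_norm_sq_to_K, (fockBasis n).orthonormal.1] at this
  simpa [entryDegree] using this.symm

end Dilation

end

end Polyball

theorem mainTheorem7 {k : ℕ} (hk : 1 ≤ k) (n : Fin k → ℕ) (hn : ∀ i, 1 ≤ n i)
    (E : Type v) [NormedAddCommGroup E] [InnerProductSpace ℂ E] [CompleteSpace E]
    (F : Polyball.PolyballMap.{u, v} n E)
    (hF : ∀ (H : Type u) [NormedAddCommGroup H] [InnerProductSpace ℂ H] [CompleteSpace H],
      (F H 0 : Polyball.HilbertTensor E H →L[ℂ] Polyball.HilbertTensor E H) = 1) :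
    (Polyball.IsFreePluriharmonic F ∧ Polyball.IsPositiveMap F) ↔
      ∃ (K : Type v) (_ : NormedAddCommGroup K) (_ : InnerProductSpace ℂ K) (_ : CompleteSpace K)
        (ι : E →ₗᵢ[ℂ] K) (V : ∀ i, Fin (n i) → (K →L[ℂ] K)),
        Polyball.IsCommutingRowIsometries V ∧
        (∀ r : ℝ, 0 ≤ r → r < 1 →
          ∃ T : Polyball.HilbertTensor E (Polyball.Fock n) →L[ℂ]
              Polyball.HilbertTensor E (Polyball.Fock n),
            Polyball.SeriesConverges (Polyball.compressionCoeff ι V)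
              (fun i j => (r : ℂ) • Polyball.creation n i j) T ∧ T.IsPositive) ∧
        ∀ (H : Type u) [NormedAddCommGroup H] [InnerProductSpace ℂ H] [CompleteSpace H]
          (X : Polyball.regularPolyball n H),
          Polyball.SeriesConverges (Polyball.compressionCoeff ι V) X.1 (F H X).1 := by
  constructor
  · rintro ⟨⟨A, hA⟩, hpos⟩
    have hser := Polyball.exists_seriesConverges_creation hpos hA
    obtain ⟨K, i₁, i₂, i₃, ι, V, hV, hcoeff⟩ := Polyball.exists_commutingRowIsometries
      (Polyball.posSemidef_toeplitz hser) (Polyball.toeplitz_one_one hF hA)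
    have hred : ∀ a b, Polyball.IsReduced a b → A a b = Polyball.compressionCoeff ι V a b :=
      fun a b h => ((hcoeff a b).trans (Polyball.toeplitz_apply_of_isReduced A h)).symm
    refine ⟨K, i₁, i₂, i₃, ι, V, hV, fun r h0 h1 => ?_, fun H _ _ _ X => (hA H X).congr hred⟩
    obtain ⟨T, hT, hTpos⟩ := hser r h0 h1
    exact ⟨T, hT.congr hred, hTpos⟩
  · rintro ⟨K, _, _, _, ι, V, -, hT, hF'⟩
    exact ⟨⟨_, hF'⟩, fun H _ _ _ X => Polyball.isPositive_of_seriesConverges hT X.2 (hF' H X)⟩
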